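/- **Setting.** Let $E$ be a Polish space with its Borel $\sigma$-algebra, let $n\ge 1$, and let $\mu_0,\dots,\mu_n$ be probability measures on $E$ such that $\mu_{k+1}\ll\mu_k$ for $0\le k\le n-1$. Let $g_{k,k+1}:E\to[0,\infty)$ be a measurable version of the density $d\mu_{k+1}/d\mu_k$, and assume $$\Gamma_g:=\max_{0\le k\le n-1}\ \sup_{x\in E} g_{k,k+1}(x)<\infty .$$ For $1\le k\le n$ let $K_k$ be a Markov kernel on $E$ that leaves $\mu_k$ invariant. Write $(K_k f)(x)=\int K_k(x,dy)f(y)$, $G_{k,k+1}f=g_{k,k+1}f$, $\mu_k(f)=\int f\,d\mu_k$, and regard $\mu_k$ also as the operator $f\mapsto\mu_k(f)$ (a constant function). Define $$\gamma_K:=1-\max_{1\le k\le n}\ \sup\big\{\|(K_k-\mu_k)f\|_{L^2(\mu_k)}:\ \mu_k(f^2)\le 1\big\}.$$ (The statement also holds for $n=0$, both maxima then being read as $0$.) **The SMC algorithm.** For $N\ge1$, the particles $\xi_0^1,\dots,\xi_0^N$ are independent with law $\mu_0$. Given the particles $\xi_k^1,\dots,\xi_k^N$ at stage $k<n$, first resample: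 draw $N$ conditionally independent particles $\hat\xi^1,\dots,\hat\xi^N$, each equal to $\xi_k^i$ with probability $g_{k,k+1}(\xi_k^i)/\sum_{j}g_{k,k+1}(\xi_k^j)$ (uniformly if all weights vanish); then mutate: draw $\xi_{k+1}^i\sim K_{k+1}(\hat\xi^i,\cdot)$, independently for $i=1,\dots,N$. Put $\mu_n^N(\varphi)=\frac1N\sum_{i=1}^N\varphi(\xi_n^i)$. **Asymptotic variance.** Put $$V_n(\varphi):=\sum_{k=0}^n V_{k,n}(\varphi),\qquad V_{k,n}(\varphi):=\big\|G_{k,k+1}K_{k+1}G_{k+1,k+2}K_{k+2}\cdots G_{n-1,n}K_n\varphi\big\|_{L^2(\mu_k)}^2,$$ with $V_{n,n}(\varphi)=\|\varphi\|_{L^2(\mu_n)}^2$. **Theorem (variance bound under a global mixing assumption).** Let $\varphi:E\to\mathbb R$ be measurable with $\mu_n(\varphi)=0$ and $\mu_n(|\varphi|^{2+\varepsilon})<\infty$ for some $\varepsilon>0$. If $\Gamma_g\,(1-\gamma_K)^2<1$, then $V_n(\varphi)<\infty$, the central limit theorem $$\sqrt N\,\big(\mu_n^N(\varphi)-\mu_n(\varphi)\big)\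 \longrightarrow\ \mathcal N\big(0,V_n(\varphi)\big)\quad\text{in distribution as }N\to\infty$$ holds, and $$V_n(\varphi)\ \le\ \frac{1}{1-(1-\gamma_K)^2\,\Gamma_g}\ \mathrm{Var}_{\mu_n}(\varphi).$$ The right-hand side depends on $n$ only through $\Gamma_g$, $\gamma_K$ and $\mu_n$. -/

import Mathlib

open MeasureTheory ProbabilityTheory Filter
open scoped NNReal ENNReal

noncomputable section

namespace SMC

variable {E : Type*} [MeasurableSpace E]

/-! ### Operators on test functions -/

/-- The Markov operator `(K f)(x) = ∫ K(x, dy) f(y)`. -/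
def markovOp (K : Kernel E E) (f : E → ℝ) : E → ℝ := fun x => ∫ y, f y ∂(K x)

/-- The operator `G f = g f` of multiplication by a relative density. -/
def densityOp (g : E → ℝ≥0) (f : E → ℝ) : E → ℝ := fun x => (g x : ℝ) * f x

/-- The operator `f ↦ μ(f)`, a constant function. -/
def meanOp (μ : Measure E) (f : E → ℝ) : E → ℝ := fun _ => ∫ y, f y ∂μ

/-- The triple norm `sup {‖L f‖_{L²(μ)} : μ(f²) ≤ 1}`. -/
def tripleNorm (μ : Measure E) (L : (E → ℝ) → (E → ℝ)) : ℝ≥0∞ :=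
  ⨆ (f : E → ℝ) (_ : MemLp f 2 μ) (_ : eLpNorm f 2 μ ≤ 1), eLpNorm (L f) 2 μ

/-- `γ_K = 1 - max {|||K_k - μ_k|||_{L²(μ_k)} : 1 ≤ k ≤ n}`. -/
def mixingGap (μ : ℕ → Measure E) (K : ℕ → Kernel E E) (n : ℕ) : ℝ :=
  1 - (⨆ k ∈ Finset.Icc 1 n,
    tripleNorm (μ k) (fun f => markovOp (K k) f - meanOp (μ k) f)).toReal

/-- `Γ_g = max {‖g_{k,k+1}‖_∞ : 0 ≤ k ≤ n - 1}`, with the supremum norm over the whole space;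
`g k` stands for `g_{k,k+1}`. -/
def maxDensity (g : ℕ → E → ℝ≥0) (n : ℕ) : ℝ≥0∞ :=
  ⨆ k ∈ Finset.range n, ⨆ x, (g k x : ℝ≥0∞)

/-- `propagate g K j k φ = G_{k,k+1} K_{k+1} G_{k+1,k+2} K_{k+2} ⋯ G_{k+j-1,k+j} K_{k+j} φ`. -/
def propagate (g : ℕ → E → ℝ≥0) (K : ℕ → Kernel E E) : ℕ → ℕ → (E → ℝ) → (E → ℝ)
  | 0, _, φ => φ
  | j + 1, k, φ => densityOp (g k) (markovOp (K (k + 1)) (propagate g K j (k + 1) φ))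

/-- `V_{k,n}(φ) = ‖G_{k,k+1} K_{k+1} ⋯ G_{n-1,n} K_n φ‖²_{L²(μ_k)}` for `k ≤ n`. -/
def stageVar (μ : ℕ → Measure E) (g : ℕ → E → ℝ≥0) (K : ℕ → Kernel E E) (n k : ℕ)
    (φ : E → ℝ) : ℝ≥0∞ :=
  eLpNorm (propagate g K (n - k) k φ) 2 (μ k) ^ 2

/-- `V_n(φ) = ∑_{k=0}^n V_{k,n}(φ)`. -/
def asymptoticVar (μ : ℕ → Measure E) (g : ℕ → E → ℝ≥0) (K : ℕ → Kernel E E) (n : ℕ)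
    (φ : E → ℝ) : ℝ≥0∞ :=
  ∑ k ∈ Finset.range (n + 1), stageVar μ g K n k φ

/-- The space `L^{2+}_0(π)` of measurable test functions with mean zero and a finite moment of
order `2 + ε` for some `ε > 0`. -/
def MemL2PlusZero (π : Measure E) (φ : E → ℝ) : Prop :=
  Measurable φ ∧ (∃ ε : ℝ, 0 < ε ∧ MemLp φ (ENNReal.ofReal (2 + ε)) π) ∧ ∫ x, φ x ∂π = 0

/-! ### The particle system -/

/-- Independent draws from finitely many Markov kernels `κ i`, started from the same point. -/
def piKernel {α β ι : Type*} [MeasurableSpace α] [MeasurableSpace β] [Fintype ι]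
    (κ : ι → Kernel α β) [∀ i, IsMarkovKernel (κ i)] : Kernel α (ι → β) where
  toFun x := Measure.pi (fun i => κ i x)
  measurable' := by
    refine Measurable.measure_of_isPiSystem_of_isProbabilityMeasure
      (generateFrom_pi (α := fun _ : ι => β)).symm isPiSystem_pi ?_
    rintro _ ⟨s, hs, rfl⟩
    simp only [Measure.pi_pi]
    exact Finset.measurable_prod _ fun i _ =>
      Kernel.measurable_coe (κ i) (hs i (Set.mem_univ i))

instance {α β ι : Type*} [MeasurableSpace α] [MeasurableSpace β] [Fintype ι]
    (κ : ι → Kernel α β) [∀ i, IsMarkovKernel (κ i)] : IsMarkovKernel (piKernel κ) :=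
  ⟨fun x => by change IsProbabilityMeasure (Measure.pi fun i => κ i x); infer_instance⟩

/-- The probability `g(xᵢ) / ∑ⱼ g(xⱼ)` with which multinomial resampling selects particle `i`.
If all the weights vanish, the selection is uniform. -/
def resampleWeight {N : ℕ} (g : E → ℝ≥0) (x : Fin N → E) (i : Fin N) : ℝ≥0 :=
  if ∑ j, g (x j) = 0 then (N : ℝ≥0)⁻¹ else g (x i) / ∑ j, g (x j)

/-- The weighted empirical distribution from which multinomial resampling draws. -/
def resampleDist (N : ℕ) (g : E → ℝ≥0) (hg : Measurable g) : Kernel (Fin N → E) E where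
  toFun x := ∑ i, (resampleWeight g x i : ℝ≥0∞) • Measure.dirac (x i)
  measurable' := by
    have hs : Measurable fun x : Fin N → E => ∑ j, g (x j) :=
      Finset.measurable_sum _ fun j _ => hg.comp (measurable_pi_apply j)
    refine Measure.measurable_of_measurable_coe _ fun s hs' => ?_
    simp only [Measure.coe_finsetSum, Finset.sum_apply, Measure.smul_apply, smul_eq_mul]
    refine Finset.measurable_sum _ fun i _ => Measurable.mul ?_ ?_
    · refine Measurable.coe_nnreal_ennreal (Measurable.ite ?_ measurable_const ?_)
      · exact hs (measurableSet_singleton 0)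
      · exact (hg.comp (measurable_pi_apply i)).div hs
    · exact (Measure.measurable_coe hs').comp
        (Measure.measurable_dirac.comp (measurable_pi_apply i))

theorem isMarkovKernel_resampleDist {N : ℕ} (i : Fin N) (g : E → ℝ≥0) (hg : Measurable g) :
    IsMarkovKernel (resampleDist N g hg) := by
  refine ⟨fun x => ⟨?_⟩⟩
  have hN : (N : ℝ≥0) ≠ 0 := by
    have := i.pos
    positivity
  have h : ∑ i, resampleWeight g x i = 1 := by
    unfold resampleWeight
    split_ifs with h0
    · simp [mul_inv_cancel₀ hN]
    · rw [← Finset.sum_div, div_self h0]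
  change (∑ i, (resampleWeight g x i : ℝ≥0∞) • Measure.dirac (x i)) Set.univ = 1
  simp only [Measure.coe_finsetSum, Finset.sum_apply, Measure.smul_apply, smul_eq_mul,
    measure_univ, mul_one]
  exact_mod_cast h

/-- Multinomial resampling: `N` independent draws from the weighted empirical distribution. -/
def resampleKernel (N : ℕ) (g : E → ℝ≥0) (hg : Measurable g) :
    Kernel (Fin N → E) (Fin N → E) :=
  @piKernel (Fin N → E) E (Fin N) _ _ _ (fun _ => resampleDist N g hg)
    (fun i => isMarkovKernel_resampleDist i g hg)

instance (N : ℕ) (g : E → ℝ≥0) (hg : Measurable g) : IsMarkovKernel (resampleKernel N g hg) := by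
  unfold resampleKernel
  infer_instance

/-- Mutation: given the particles, particle `i` moves to a draw from `K (xᵢ, ·)`, independently
of the other ones. -/
def mutateKernel (N : ℕ) (K : Kernel E E) [IsMarkovKernel K] : Kernel (Fin N → E) (Fin N → E) :=
  piKernel fun i : Fin N => K.comap (fun x : Fin N → E => x i) (measurable_pi_apply i)

instance (N : ℕ) (K : Kernel E E) [IsMarkovKernel K] : IsMarkovKernel (mutateKernel N K) := by
  unfold mutateKernel
  infer_instance

/-- The joint law of the `N` particles at stage `k` of the SMC algorithm: at stage `0` they are
independent draws from `μ₀`; stage `k + 1` is obtained from stage `k` by multinomial resampling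
with weights `g_{k,k+1}` and then mutation with `K_{k+1}`. -/
def particleLaw (μ₀ : Measure E) (g : ℕ → E → ℝ≥0) (hg : ∀ k, Measurable (g k))
    (K : ℕ → Kernel E E) [∀ k, IsMarkovKernel (K k)] (N : ℕ) : ℕ → Measure (Fin N → E)
  | 0 => Measure.pi fun _ => μ₀
  | k + 1 => ((particleLaw μ₀ g hg K N k).bind (resampleKernel N (g k) (hg k))).bind
      (mutateKernel N (K (k + 1)))

instance (μ₀ : Measure E) [IsProbabilityMeasure μ₀] (g : ℕ → E → ℝ≥0)
    (hg : ∀ k, Measurable (g k)) (K : ℕ → Kernel E E) [∀ k, IsMarkovKernel (K k)] (N k : ℕ) :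
    IsProbabilityMeasure (particleLaw μ₀ g hg K N k) := by
  induction k with
  | zero => unfold particleLaw; infer_instance
  | succ k ih => unfold particleLaw; infer_instance

/-- The empirical measure `(1/N) ∑ᵢ δ_{xᵢ}` of the particles, integrated against `φ`. -/
def empiricalMean {N : ℕ} (φ : E → ℝ) (x : Fin N → E) : ℝ := (N : ℝ)⁻¹ * ∑ i, φ (x i)

end SMC

end

/-! Write $Q_{k+1}=G_{k,k+1}K_{k+1}$. Given stage $k$, the particles of stage $k+1$ are i.i.d. from
a random law $\nu$ with $\nu(f)=\mu_k^N(Q_{k+1}f)/\mu_k^N(g_{k,k+1})$, and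
$\mu_k(Q_{k+1}f)=\mu_{k+1}(f)$ because $K_{k+1}$ leaves $\mu_{k+1}$ invariant.

The central limit theorem follows by induction on $k$ through characteristic functions.
Conditionally on stage $k$, the characteristic function of $\sqrt N\mu_{k+1}^N(f)$ at $t$ is an
$N$-th power, close to $e^{-t^2\mu_{k+1}(f^2)/2}\,e^{it\sqrt N\nu(f)}$. Since
$\mu_k^N(g_{k,k+1})\to1$, Slutsky's argument replaces $\sqrt N\nu(f)$ by $\sqrt N\mu_k^N(Q_{k+1}f)$,
to which the induction hypothesis applies. Taking expectations gives
$V_{k+1}(f)=V_k(Q_{k+1}f)+\mu_{k+1}(f^2)$, the recursion of `asymptoticVar_succ`. The step is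
`EmpiricalCLT.step`. It needs a weak law for all integrable functions (`EmpiricalLLN.step`) and the
fact that particles avoid null sets (`AvoidsNull.step`), since $K_{k+1}f$ is a genuine integral only
almost everywhere.

For the variance bound, $\int g^2h^2\,d\mu_k\le\Gamma_g\int h^2\,d\mu_{k+1}$, and on centred
functions $K_{k+1}$ has $L^2$ norm at most $1-\gamma_K$. As $Q_{k+1}$ preserves centring, each
backward step multiplies the squared norm by at most $r=\Gamma_g(1-\gamma_K)^2$ (`propagate_bound`),
and $V_n(\varphi)$ is dominated by a geometric series. -/

open scoped Topology

/-! ### Convergence in probability on varying spaces -/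

section InProbability

variable {ι : Type*} {Ω : ι → Type*} [∀ i, MeasurableSpace (Ω i)]

/-- The filter on `Σ i, Ω i` of the events whose probability under `P i` tends to `1` along `l`.
Convergence in probability of random variables defined on varying probability spaces is
convergence along this filter. -/
def inProb (P : ∀ i, Measure (Ω i)) (l : Filter ι) : Filter (Σ i, Ω i) where
  sets := {A | Tendsto (fun i => P i {x | (⟨i, x⟩ : Σ i, Ω i) ∉ A}) l (𝓝 0)}
  univ_sets := by simp [tendsto_const_nhds]
  sets_of_superset {A B} hA hAB :=
    tendsto_of_tendsto_of_tendsto_of_le_of_le tendsto_const_nhds hA (fun _ => zero_le)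
      fun _ => measure_mono fun _ hx h => hx (hAB h)
  inter_sets {A B} hA hB := by
    refine tendsto_of_tendsto_of_tendsto_of_le_of_le tendsto_const_nhds
      (by simpa using Tendsto.add hA hB) (fun _ => zero_le) fun i => ?_
    refine le_trans (measure_mono fun x hx => ?_) (measure_union_le _ _)
    by_contra h
    simp only [Set.mem_union, Set.mem_ofPred_eq, not_or, not_not] at h
    exact hx h

variable {P : ∀ i, Measure (Ω i)} {l : Filter ι}

theorem eventually_inProb {p : (Σ i, Ω i) → Prop} :
    (∀ᶠ ω in inProb P l, p ω) ↔ Tendsto (fun i => P i {x | ¬ p ⟨i, x⟩}) l (𝓝 0) := Iff.rfl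

theorem tendsto_fst_inProb : Tendsto Sigma.fst (inProb P l) l := by
  intro s hs
  refine tendsto_const_nhds.congr' ?_
  filter_upwards [hs] with i hi
  simp [hi]

theorem tendsto_inProb_of_measure {X : ∀ i, Ω i → ℝ} {a : ℝ}
    (h : ∀ ε > 0, Tendsto (fun i => P i {x | ε ≤ dist (X i x) a}) l (𝓝 0)) :
    Tendsto (fun ω : Σ i, Ω i => X ω.1 ω.2) (inProb P l) (𝓝 a) := by
  rw [Metric.tendsto_nhds]
  intro ε hε
  rw [eventually_inProb]
  simpa using h ε hε

/-- Bounded convergence: a bounded sequence that tends to `0` in probability tends to `0` in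
mean. -/
theorem tendsto_integral_of_inProb [∀ i, IsProbabilityMeasure (P i)] {F : ∀ i, Ω i → ℂ} {C : ℝ}
    (hC : ∀ i x, ‖F i x‖ ≤ C)
    (h : Tendsto (fun ω : Σ i, Ω i => F ω.1 ω.2) (inProb P l) (𝓝 0)) :
    Tendsto (fun i => ∫ x, F i x ∂(P i)) l (𝓝 0) := by
  rw [Metric.tendsto_nhds]
  intro ε hε
  have h1 := (Metric.tendsto_nhds.1 h) (ε / 2) (by positivity)
  rw [eventually_inProb] at h1
  have h2 : Tendsto (fun i => ENNReal.ofReal (ε / 2) + ENNReal.ofReal C *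
      P i {x | ¬ dist (F i x) 0 < ε / 2}) l (𝓝 (ENNReal.ofReal (ε / 2))) := by
    simpa using (ENNReal.Tendsto.const_mul h1 (Or.inr ENNReal.ofReal_ne_top)).const_add
      (ENNReal.ofReal (ε / 2))
  filter_upwards [h2.eventually_lt_const
    ((ENNReal.ofReal_lt_ofReal_iff hε).2 (half_lt_self hε))] with i hi
  rw [dist_zero_right, ← ENNReal.ofReal_lt_ofReal_iff hε]
  refine lt_of_le_of_lt ?_ hi
  rw [ofReal_norm]
  refine (enorm_integral_le_lintegral_enorm _).trans ?_
  -- `F` need not be measurable, so the bad event is replaced by a measurable hull of the same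
  -- measure.
  set A := toMeasurable (P i) {x | ¬ dist (F i x) 0 < ε / 2} with hA
  have : ∀ x, ‖F i x‖ₑ ≤ ENNReal.ofReal (ε / 2) +
      A.indicator (fun _ => ENNReal.ofReal C) x := by
    intro x
    rw [← ofReal_norm]
    by_cases hx : x ∈ A
    · rw [Set.indicator_of_mem hx]
      exact (ENNReal.ofReal_le_ofReal (hC i x)).trans le_add_self
    · have : ¬ ¬ dist (F i x) 0 < ε / 2 := fun hh => hx (subset_toMeasurable _ _ hh)
      rw [not_not, dist_zero_right] at this
      exact (ENNReal.ofReal_le_ofReal this.le).trans le_self_add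
  refine (lintegral_mono this).trans ?_
  rw [lintegral_add_left measurable_const, lintegral_indicator_const (measurableSet_toMeasurable _ _),
    measure_toMeasurable]
  simp

end InProbability

/-! ### Lévy continuity and tightness -/

section CharacteristicFunctions

variable {Ω : ℕ → Type*} [∀ i, MeasurableSpace (Ω i)] {P : ∀ i, Measure (Ω i)}
  [∀ i, IsProbabilityMeasure (P i)]

theorem charFun_map_real {α : Type*} [MeasurableSpace α] {μ : Measure α} {X : α → ℝ}
    (hX : Measurable X) (t : ℝ) :
    charFun (μ.map X) t = ∫ x, Complex.exp (t * X x * Complex.I) ∂μ := by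
  rw [charFun_apply_real, integral_map hX.aemeasurable]
  exact Continuous.aestronglyMeasurable (by fun_prop)

/-- Lévy's continuity theorem with a constant limit. -/
theorem tendsto_inProb_of_charFun {X : ∀ i, Ω i → ℝ} (hX : ∀ i, Measurable (X i)) {a : ℝ}
    (h : ∀ t : ℝ, Tendsto (fun i => ∫ x, Complex.exp (t * X i x * Complex.I) ∂(P i)) atTop
      (𝓝 (Complex.exp (t * a * Complex.I)))) :
    Tendsto (fun ω : Σ i, Ω i => X ω.1 ω.2) (inProb P atTop) (𝓝 a) := by
  have hp : ∀ i, IsProbabilityMeasure ((P i).map (X i)) := fun i =>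
    Measure.isProbabilityMeasure_map (hX i).aemeasurable
  have key : Tendsto (β := ProbabilityMeasure ℝ) (fun i => ⟨(P i).map (X i), hp i⟩) atTop
      (𝓝 ⟨Measure.dirac a, inferInstance⟩) := by
    refine ProbabilityMeasure.tendsto_iff_tendsto_charFun.2 fun t => ?_
    simp only [ProbabilityMeasure.coe_mk, charFun_map_real (hX _), charFun_dirac]
    convert h t using 3
    simp
  refine tendsto_inProb_of_measure fun ε hε => ?_
  -- The set is closed and misses `a`, so the limit law does not charge its frontier and the
  -- portmanteau theorem applies.
  have hfr : Measure.dirac a (frontier {x : ℝ | ε ≤ dist x a}) = 0 := by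
    rw [Measure.dirac_apply' _ isClosed_frontier.measurableSet]
    have : a ∉ frontier {x : ℝ | ε ≤ dist x a} := fun hh => by
      have := (isClosed_le continuous_const (by fun_prop :
        Continuous fun x : ℝ => dist x a)).frontier_subset hh
      simp at this
      linarith
    simp [this]
  have := ProbabilityMeasure.tendsto_measure_of_null_frontier_of_tendsto' key hfr
  have hm : MeasurableSet {x : ℝ | ε ≤ dist x a} :=
    (isClosed_le continuous_const (by fun_prop)).measurableSet
  simp only [ProbabilityMeasure.coe_mk, Measure.map_apply (hX _) hm] at this
  rw [Measure.dirac_apply' _ hm, Set.indicator_of_notMem (by simpa using hε)] at this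
  exact this

/-- A sequence with converging characteristic functions is bounded in probability, so its product
with a sequence that tends to `0` in probability tends to `0` in probability. -/
theorem tendsto_mul_of_charFun {X : ∀ i, Ω i → ℝ} (hX : ∀ i, Measurable (X i)) {f : ℝ → ℂ}
    (hf : ContinuousAt f 0)
    (h : ∀ t : ℝ, Tendsto (fun i => ∫ x, Complex.exp (t * X i x * Complex.I) ∂(P i)) atTop
      (𝓝 (f t)))
    {δ : (Σ i, Ω i) → ℝ} (hδ : Tendsto δ (inProb P atTop) (𝓝 0)) :
    Tendsto (fun ω : Σ i, Ω i => X ω.1 ω.2 * δ ω) (inProb P atTop) (𝓝 0) := by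
  have hp : ∀ i, IsProbabilityMeasure ((P i).map (X i)) := fun i =>
    Measure.isProbabilityMeasure_map (hX i).aemeasurable
  have ht := isTightMeasureSet_of_tendsto_charFun (μ := fun i => (P i).map (X i)) hf
    (fun t => by simpa only [charFun_map_real (hX _)] using h t)
  rw [isTightMeasureSet_iff_tendsto_measure_norm_gt] at ht
  refine tendsto_inProb_of_measure (X := fun i x => X i x * δ ⟨i, x⟩) fun ε hε => ?_
  rw [ENNReal.tendsto_nhds_zero]
  intro η hη
  have hη2 : 0 < η / 2 := ENNReal.half_pos hη.ne'
  -- Tightness makes `|X| > r` unlikely; outside that event `|X δ| ≥ ε` forces `|δ| ≥ ε / r`.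
  obtain ⟨r, hr, hr0⟩ := ((ENNReal.tendsto_nhds_zero.1 ht (η / 2) hη2).and
    (eventually_gt_atTop 0)).exists
  have h1 := (Metric.tendsto_nhds.1 hδ) (ε / r) (by positivity)
  rw [eventually_inProb] at h1
  filter_upwards [ENNReal.tendsto_nhds_zero.1 h1 (η / 2) hη2] with i hi
  have hm : MeasurableSet {x : ℝ | r < ‖x‖} := measurableSet_lt measurable_const measurable_norm
  have h2 : P i {x | r < ‖X i x‖} ≤ η / 2 := by
    refine le_trans ?_ ((le_iSup₂ (f := fun (μ : Measure ℝ)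
      (_ : μ ∈ Set.range fun i => (P i).map (X i)) => μ {x | r < ‖x‖})
      ((P i).map (X i)) ⟨i, rfl⟩).trans hr)
    rw [Measure.map_apply (hX i) hm]
    rfl
  rw [← ENNReal.add_halves η]
  refine le_trans (measure_mono fun x hx => ?_) ((measure_union_le _ _).trans (add_le_add h2 hi))
  by_contra hh
  simp only [Set.mem_union, Set.mem_ofPred_eq, not_or, not_lt, dist_zero_right] at hh hx
  rw [norm_mul] at hx
  have : ‖X i x‖ * ‖δ ⟨i, x⟩‖ ≤ r * ‖δ ⟨i, x⟩‖ := by gcongr; exact hh.1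
  have h3 : r * ‖δ ⟨i, x⟩‖ < ε := by
    have := mul_lt_mul_of_pos_left (not_le.1 hh.2) hr0
    rwa [mul_div_cancel₀ _ hr0.ne'] at this
  linarith

end CharacteristicFunctions

/-! ### Powers and Taylor bounds of exponentials -/

section Exponentials

/-- Telescoping in the unit disc. It allows $a^N$ to be compared with $(e^{z/N})^N$ without a
complex logarithm. -/
theorem norm_pow_sub_pow_le_mul_norm_sub {a b : ℂ} (ha : ‖a‖ ≤ 1) (hb : ‖b‖ ≤ 1) (n : ℕ) :
    ‖a ^ n - b ^ n‖ ≤ n * ‖a - b‖ := by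
  induction n with
  | zero => simp
  | succ n ih =>
    have : a ^ (n + 1) - b ^ (n + 1) = a ^ n * (a - b) + (a ^ n - b ^ n) * b := by ring
    rw [this]
    refine (norm_add_le _ _).trans ?_
    rw [norm_mul, norm_mul, norm_pow]
    have h1 : ‖a‖ ^ n * ‖a - b‖ ≤ 1 * ‖a - b‖ := by
      gcongr
      exact pow_le_one₀ (norm_nonneg _) ha
    have h2 : ‖a ^ n - b ^ n‖ * ‖b‖ ≤ n * ‖a - b‖ * 1 := by gcongr
    push_cast
    linarith

/-- Powers `a ^ N → exp z` along an arbitrary filter, when `N (a - 1) → z`. -/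
theorem tendsto_pow_cexp {Ω : Type*} {l : Filter Ω} {N : Ω → ℕ} (hN : Tendsto N l atTop)
    {a : Ω → ℂ} (ha : ∀ᶠ ω in l, ‖a ω‖ ≤ 1) {z : ℂ} (hz : z.re ≤ 0)
    (h : Tendsto (fun ω => (N ω : ℂ) * (a ω - 1)) l (𝓝 z)) :
    Tendsto (fun ω => a ω ^ N ω) l (𝓝 (Complex.exp z)) := by
  have hNr : Tendsto (fun ω => (N ω : ℝ)) l atTop := tendsto_natCast_atTop_atTop.comp hN
  have h1 : Tendsto (fun ω => (N ω : ℂ) * (Complex.exp (z / N ω) - 1)) l (𝓝 z) := by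
    rw [tendsto_iff_norm_sub_tendsto_zero]
    refine squeeze_zero' (.of_forall fun _ => norm_nonneg _) ?_
      (hNr.const_div_atTop (‖z‖ ^ 2))
    filter_upwards [hNr.eventually_ge_atTop ‖z‖, hNr.eventually_gt_atTop 0] with ω hω h0
    have hc : (N ω : ℂ) ≠ 0 := by exact_mod_cast h0.ne'
    have hle : ‖z / N ω‖ ≤ 1 := by
      rw [norm_div, Complex.norm_natCast]
      exact div_le_one_of_le₀ hω h0.le
    have : (N ω : ℂ) * (Complex.exp (z / N ω) - 1) - z =
        N ω * (Complex.exp (z / N ω) - 1 - z / N ω) := by field_simp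
    rw [this, norm_mul, Complex.norm_natCast]
    refine (mul_le_mul_of_nonneg_left (Complex.norm_exp_sub_one_sub_id_le hle) h0.le).trans ?_
    rw [norm_div, Complex.norm_natCast]
    apply le_of_eq
    field_simp
  rw [tendsto_iff_norm_sub_tendsto_zero]
  have h2 := (h.sub h1).norm
  rw [sub_self, norm_zero] at h2
  refine squeeze_zero' (.of_forall fun _ => norm_nonneg _) ?_ h2
  filter_upwards [hNr.eventually_gt_atTop 0, ha] with ω h0 hle
  have hc : (N ω : ℂ) ≠ 0 := by exact_mod_cast h0.ne'
  -- Both bases lie in the unit disc, the second because $\mathrm{Re}\,z\le0$, so the powers differ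
  -- by at most $N|a-e^{z/N}|$.
  have he : Complex.exp z = Complex.exp (z / N ω) ^ N ω := by
    rw [← Complex.exp_nat_mul, mul_div_cancel₀ _ hc]
  have hb : ‖Complex.exp (z / N ω)‖ ≤ 1 := by
    rw [Complex.norm_exp, Real.exp_le_one_iff, Complex.div_natCast_re]
    exact div_nonpos_of_nonpos_of_nonneg hz h0.le
  rw [he]
  refine (norm_pow_sub_pow_le_mul_norm_sub hle hb _).trans (le_of_eq ?_)
  rw [← mul_sub, norm_mul, Complex.norm_natCast]
  congr 2
  ring

/-- The triangle inequality for $|y|\ge1$, Taylor's formula for $|y|\le1$. The factor $\min(1,|y|)$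
makes the remainder negligible under a first moment alone. -/
theorem norm_cexp_sub_one_sub_le (y : ℝ) :
    ‖Complex.exp (Complex.I * y) - 1 - Complex.I * y‖ ≤ 2 * (|y| * min 1 |y|) := by
  have h1 : ‖Complex.exp (Complex.I * y) - 1 - Complex.I * y‖ ≤ 2 * |y| := by
    refine (norm_sub_le _ _).trans ?_
    have := Real.norm_exp_I_mul_ofReal_sub_one_le (x := y)
    have h2 : ‖Complex.I * (y : ℂ)‖ = |y| := by simp
    rw [Real.norm_eq_abs] at this
    linarith
  rcases le_total 1 |y| with hy | hy
  · rwa [min_eq_left hy, mul_one]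
  · rw [min_eq_right hy]
    have h2 : ‖Complex.I * (y : ℂ)‖ = |y| := by simp
    have := Complex.norm_exp_sub_one_sub_id_le (x := Complex.I * y) (h2 ▸ hy)
    rw [h2] at this
    nlinarith [sq_nonneg |y|]

/-- The second-order analogue, usable under a second moment alone. For $|y|\ge1$ the terms
$2|y|+y^2/2$ stay below $3y^2$; for $|y|\le1$ the cubic remainder has a smaller constant. -/
theorem norm_cexp_sub_one_sub_add_le (y : ℝ) :
    ‖Complex.exp (Complex.I * y) - 1 - Complex.I * y + (y ^ 2 / 2 : ℝ)‖ ≤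
      3 * (y ^ 2 * min 1 |y|) := by
  have h2 : ‖Complex.I * (y : ℂ)‖ = |y| := by simp
  rcases le_total 1 |y| with hy | hy
  · rw [min_eq_left hy]
    refine (norm_add_le _ _).trans ?_
    have := norm_cexp_sub_one_sub_le y
    rw [min_eq_left hy] at this
    rw [Complex.norm_real, Real.norm_of_nonneg (by positivity), ← sq_abs]
    nlinarith
  · rw [min_eq_right hy]
    have := Complex.exp_bound (x := Complex.I * y) (h2 ▸ hy) (n := 3) (by norm_num)
    rw [h2] at this
    have he : Complex.exp (Complex.I * y) - ∑ m ∈ Finset.range 3,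
        (Complex.I * (y : ℂ)) ^ m / (m.factorial : ℂ) =
        Complex.exp (Complex.I * y) - 1 - Complex.I * y + (y ^ 2 / 2 : ℝ) := by
      simp [Finset.sum_range_succ, mul_pow]
      ring
    rw [he] at this
    refine this.trans ?_
    rw [← sq_abs, ← pow_succ, mul_comm]
    gcongr
    norm_num [Nat.factorial]

end Exponentials

/-! ### Limit theorems for independent draws from a random law -/

section Means

variable {Ω E : Type*} [MeasurableSpace E]

/-- The measures `ν ω` converge to `μ` along `l` on all measurable `μ`-integrable functions. -/
def MeansTendsto (l : Filter Ω) (ν : Ω → Measure E) (μ : Measure E) : Prop :=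
  ∀ f : E → ℝ, Measurable f → Integrable f μ →
    (∀ᶠ ω in l, Integrable f (ν ω)) ∧ Tendsto (fun ω => ∫ x, f x ∂ν ω) l (𝓝 (∫ x, f x ∂μ))

variable {l : Filter Ω} {ν : Ω → Measure E} {μ : Measure E}

theorem integrable_mul_min {m : Measure E} {ψ χ : E → ℝ} (hψ : Integrable ψ m) (hχm : Measurable χ)
    (hχ0 : ∀ x, 0 ≤ χ x) {M : ℝ} (hM : 0 ≤ M) : Integrable (fun x => ψ x * min 1 (χ x / M)) m := by
  refine hψ.mul_bdd (c := 1) (by fun_prop) (.of_forall fun x => ?_)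
  have : 0 ≤ min 1 (χ x / M) := le_min zero_le_one (div_nonneg (hχ0 x) hM)
  rw [Real.norm_of_nonneg this]
  exact min_le_left _ _

/-- This is the Lindeberg condition. Once $c\ge M$ the integrand is below $\psi\min(1,\chi/M)$, a
fixed integrable function whose means converge; its $\mu$-integral vanishes as $M\to\infty$ by
dominated convergence. -/
theorem MeansTendsto.tendsto_integral_mul_min (h : MeansTendsto l ν μ) {ψ χ : E → ℝ}
    (hψm : Measurable ψ) (hψ : Integrable ψ μ) (hψ0 : ∀ x, 0 ≤ ψ x) (hχm : Measurable χ)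
    (hχ0 : ∀ x, 0 ≤ χ x) {c : Ω → ℝ} (hc : Tendsto c l atTop) :
    Tendsto (fun ω => ∫ x, ψ x * min 1 (χ x / c ω) ∂ν ω) l (𝓝 0) := by
  have hlim : Tendsto (fun M : ℝ => ∫ x, ψ x * min 1 (χ x / M) ∂μ) atTop (𝓝 0) := by
    have h0 : ∫ x, ψ x * (0 : ℝ) ∂μ = 0 := by simp
    rw [← h0]
    refine tendsto_integral_filter_of_dominated_convergence ψ (.of_forall fun M => ?_) ?_ hψ
      (.of_forall fun x => ?_)
    · fun_prop
    · filter_upwards [eventually_ge_atTop 0] with M hM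
      refine .of_forall fun x => ?_
      have : 0 ≤ min 1 (χ x / M) := le_min zero_le_one (div_nonneg (hχ0 x) hM)
      rw [Real.norm_of_nonneg (mul_nonneg (hψ0 x) this)]
      exact mul_le_of_le_one_right (hψ0 x) (min_le_left _ _)
    · have : Tendsto (fun M : ℝ => min 1 (χ x / M)) atTop (𝓝 (min 1 0)) :=
        tendsto_const_nhds.min (tendsto_id.const_div_atTop _)
      rw [min_eq_right zero_le_one] at this
      exact this.const_mul _
  rw [Metric.tendsto_nhds]
  intro ε hε
  obtain ⟨M, hMε, hM0⟩ := ((hlim.eventually_lt_const hε).and (eventually_gt_atTop 0)).exists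
  obtain ⟨-, hM⟩ := h (fun x => ψ x * min 1 (χ x / M)) (by fun_prop)
    (integrable_mul_min hψ hχm hχ0 hM0.le)
  filter_upwards [hM.eventually_lt_const hMε, hc.eventually_ge_atTop M, (h ψ hψm hψ).1]
    with ω h1 h2 h3
  have hc0 : 0 ≤ c ω := hM0.le.trans h2
  rw [dist_zero_right, Real.norm_of_nonneg (integral_nonneg fun x =>
    mul_nonneg (hψ0 x) (le_min zero_le_one (div_nonneg (hχ0 x) hc0)))]
  refine lt_of_le_of_lt (integral_mono (integrable_mul_min h3 hχm hχ0 hc0)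
    (integrable_mul_min h3 hχm hχ0 hM0.le) fun x => ?_) h1
  have := hψ0 x
  have := hχ0 x
  dsimp only
  gcongr

theorem integrable_cexp_I_mul {m : Measure E} [IsFiniteMeasure m] {f : E → ℝ} (hf : Measurable f) :
    Integrable (fun x => Complex.exp (Complex.I * f x)) m :=
  Integrable.of_bound (by fun_prop) 1 (.of_forall fun x => by
    rw [Complex.norm_exp_I_mul_ofReal])

theorem norm_integral_cexp_I_mul_le (m : Measure E) [IsProbabilityMeasure m] (f : E → ℝ) :
    ‖∫ x, Complex.exp (Complex.I * f x) ∂m‖ ≤ 1 := by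
  simpa using norm_integral_le_of_norm_le_const (μ := m) (C := 1)
    (f := fun x => Complex.exp (Complex.I * f x))
    (.of_forall fun x => by rw [Complex.norm_exp_I_mul_ofReal])

/-- Weak law of large numbers for independent draws from `ν ω`, in terms of characteristic
functions. -/
theorem MeansTendsto.tendsto_pow_lln (h : MeansTendsto l ν μ)
    (hν : ∀ᶠ ω in l, IsProbabilityMeasure (ν ω)) {N : Ω → ℕ} (hN : Tendsto N l atTop)
    {f : E → ℝ} (hfm : Measurable f) (hf : Integrable f μ) :
    Tendsto (fun ω => (∫ x, Complex.exp (Complex.I * (f x / N ω : ℝ)) ∂ν ω) ^ N ω) l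
      (𝓝 (Complex.exp (Complex.I * (∫ x, f x ∂μ : ℝ)))) := by
  have hNr : Tendsto (fun ω => (N ω : ℝ)) l atTop := tendsto_natCast_atTop_atTop.comp hN
  refine tendsto_pow_cexp hN ?_ (by simp) ?_
  · filter_upwards [hν] with ω _ using norm_integral_cexp_I_mul_le _ _
  have h1 : Tendsto (fun ω => Complex.I * (∫ x, f x ∂ν ω : ℝ)) l
      (𝓝 (Complex.I * (∫ x, f x ∂μ : ℝ))) :=
    ((Complex.continuous_ofReal.tendsto _).comp (h f hfm hf).2).const_mul _
  refine (tendsto_iff_of_dist ?_).2 h1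
  have h2 := (h.tendsto_integral_mul_min (ψ := fun x => |f x|) (χ := fun x => |f x|)
    (by fun_prop) hf.abs (fun _ => abs_nonneg _) (by fun_prop) (fun _ => abs_nonneg _) hNr).const_mul 2
  rw [mul_zero] at h2
  refine squeeze_zero' (.of_forall fun _ => dist_nonneg) ?_ h2
  filter_upwards [hν, (h f hfm hf).1, hNr.eventually_gt_atTop 0] with ω _ hfi h0
  have hc : (N ω : ℂ) ≠ 0 := by exact_mod_cast h0.ne'
  have hint := integrable_cexp_I_mul (m := ν ω) (f := fun x => f x / N ω) (by fun_prop)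
  have e : (N ω : ℂ) * (∫ x, Complex.exp (Complex.I * (f x / N ω : ℝ)) ∂ν ω - 1) -
      Complex.I * (∫ x, f x ∂ν ω : ℝ) = ∫ x, (N ω : ℂ) *
        (Complex.exp (Complex.I * (f x / N ω : ℝ)) - 1 - Complex.I * (f x / N ω : ℝ)) ∂ν ω := by
    have hint1 : Integrable (fun x => Complex.exp (Complex.I * (f x / N ω : ℝ)) - 1) (ν ω) :=
      hint.sub (integrable_const _)
    have hint2 : Integrable (fun x => Complex.I * ((f x / N ω : ℝ) : ℂ)) (ν ω) :=
      Integrable.const_mul (hfi.div_const _).ofReal _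
    rw [integral_const_mul, integral_sub hint1 hint2, integral_sub hint (integrable_const _),
      integral_const_mul, integral_complex_ofReal, integral_div]
    simp
    field_simp
  rw [dist_eq_norm, e, ← integral_const_mul]
  refine norm_integral_le_of_norm_le
    ((integrable_mul_min hfi.abs (by fun_prop) (fun _ => abs_nonneg _) h0.le).const_mul 2)
    (.of_forall fun x => ?_)
  rw [norm_mul, Complex.norm_natCast]
  refine (mul_le_mul_of_nonneg_left (norm_cexp_sub_one_sub_le _) h0.le).trans (le_of_eq ?_)
  rw [abs_div, abs_of_pos h0]
  field_simp

/-- Conditional central limit theorem for independent draws from `ν ω`, in terms of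
characteristic functions. -/
theorem MeansTendsto.tendsto_pow_clt_centered (h : MeansTendsto l ν μ) [IsProbabilityMeasure μ]
    (hν : ∀ᶠ ω in l, IsProbabilityMeasure (ν ω)) {N : Ω → ℕ} (hN : Tendsto N l atTop)
    {f : E → ℝ} (hfm : Measurable f) (hf : MemLp f 2 μ) (hf0 : ∫ x, f x ∂μ = 0) :
    Tendsto (fun ω => (∫ x, Complex.exp (Complex.I *
      ((f x - ∫ y, f y ∂ν ω) / √(N ω) : ℝ)) ∂ν ω) ^ N ω) l
      (𝓝 (Complex.exp (-(∫ x, f x ^ 2 ∂μ : ℝ) / 2))) := by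
  have hNr : Tendsto (fun ω => (N ω : ℝ)) l atTop := tendsto_natCast_atTop_atTop.comp hN
  have hf1 : Integrable f μ := hf.integrable one_le_two
  have hf2 : Integrable (fun x => f x ^ 2) μ := hf.integrable_sq
  -- The random centring `u` tends to `0`, so eventually `|u| ≤ 1` and `(|f| + 1) ^ 2` dominates `(f
  -- - u) ^ 2` independently of `ω`.
  have hp2 : Integrable (fun x => (|f x| + 1) ^ 2) μ :=
    (hf.abs.add (memLp_const (1 : ℝ))).integrable_sq
  refine tendsto_pow_cexp hN ?_ ?_ ?_
  · filter_upwards [hν] with ω _ using norm_integral_cexp_I_mul_le _ _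
  · have : 0 ≤ ∫ x, f x ^ 2 ∂μ := integral_nonneg fun x => sq_nonneg _
    rw [show (-((∫ x, f x ^ 2 ∂μ : ℝ) : ℂ) / 2) = ((-(∫ x, f x ^ 2 ∂μ) / 2 : ℝ) : ℂ) by
      push_cast; ring, Complex.ofReal_re]
    linarith
  have hu := (h f hfm hf1).2
  rw [hf0] at hu
  -- The conditional variance `ν(f²) - ν(f)²` tends to `μ(f²)`.
  have h1 : Tendsto (fun ω => ((-(∫ x, f x ^ 2 ∂ν ω - (∫ x, f x ∂ν ω) ^ 2) / 2 : ℝ) : ℂ)) l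
      (𝓝 (-(∫ x, f x ^ 2 ∂μ : ℝ) / 2)) := by
    have := ((((h _ (hfm.pow_const 2) hf2).2).sub (hu.pow 2)).neg.div_const 2)
    refine ((Complex.continuous_ofReal.tendsto _).comp this).trans (le_of_eq ?_)
    congr 1
    push_cast
    ring
  refine (tendsto_iff_of_dist ?_).2 h1
  have h2 := (h.tendsto_integral_mul_min (ψ := fun x => (|f x| + 1) ^ 2)
    (χ := fun x => |f x| + 1) (by fun_prop) hp2 (fun _ => by positivity) (by fun_prop)
    (fun _ => by positivity) (Real.tendsto_sqrt_atTop.comp hNr)).const_mul 3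
  rw [mul_zero] at h2
  refine squeeze_zero' (.of_forall fun _ => dist_nonneg) ?_ h2
  filter_upwards [hν, (h f hfm hf1).1, (h _ (hfm.pow_const 2) hf2).1, hNr.eventually_gt_atTop 0,
    (h _ (by fun_prop) hp2).1, hu.eventually (Metric.ball_mem_nhds _ one_pos)]
    with ω _ hfi hfi2 h0 hpi hu1
  set u := ∫ x, f x ∂ν ω with hudef
  have hu1 : |u| ≤ 1 := by
    simpa using (mem_ball_zero_iff.1 hu1).le
  have hs0 : 0 < √(N ω : ℝ) := Real.sqrt_pos.2 h0
  have hss : √(N ω : ℝ) ^ 2 = N ω := Real.sq_sqrt h0.le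
  have hint := integrable_cexp_I_mul (m := ν ω) (f := fun x => (f x - u) / √(N ω)) (by fun_prop)
  have hlin : Integrable (fun x => (f x - u) / √(N ω)) (ν ω) :=
    (hfi.sub (integrable_const _)).div_const _
  have hsq : Integrable (fun x => ((f x - u) / √(N ω)) ^ 2 / 2) (ν ω) := by
    have : (fun x => ((f x - u) / √(N ω)) ^ 2 / 2) = fun x =>
      (f x ^ 2 - 2 * u * f x + u ^ 2) / (2 * N ω) := by
      ext x
      rw [div_pow, hss]
      field_simp
      ring
    rw [this]
    exact ((hfi2.sub (hfi.const_mul _)).add (integrable_const _)).div_const _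
  have hlin0 : ∫ x, (f x - u) / √(N ω) ∂ν ω = 0 := by
    rw [integral_div, integral_sub hfi (integrable_const _)]
    simp [← hudef]
  have hsqv : (N ω : ℝ) * ∫ x, ((f x - u) / √(N ω)) ^ 2 / 2 ∂ν ω =
      (∫ x, f x ^ 2 ∂ν ω - u ^ 2) / 2 := by
    have : (fun x => ((f x - u) / √(N ω)) ^ 2 / 2) = fun x =>
      (f x ^ 2 - 2 * u * f x + u ^ 2) / (2 * N ω) := by
      ext x
      rw [div_pow, hss]
      field_simp
      ring
    have hsub : Integrable (fun x => f x ^ 2 - 2 * u * f x) (ν ω) := hfi2.sub (hfi.const_mul _)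
    rw [this, integral_div, integral_add hsub (integrable_const _),
      integral_sub hfi2 (hfi.const_mul _), integral_const_mul, ← hudef]
    simp
    field_simp
    ring
  have e : (N ω : ℂ) * (∫ x, Complex.exp (Complex.I * ((f x - u) / √(N ω) : ℝ)) ∂ν ω - 1) -
      ((-(∫ x, f x ^ 2 ∂ν ω - u ^ 2) / 2 : ℝ) : ℂ) = ∫ x, (N ω : ℂ) *
        (Complex.exp (Complex.I * ((f x - u) / √(N ω) : ℝ)) - 1 -
          Complex.I * ((f x - u) / √(N ω) : ℝ) + (((f x - u) / √(N ω)) ^ 2 / 2 : ℝ)) ∂ν ω := by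
    have hint1 : Integrable (fun x => Complex.exp (Complex.I * ((f x - u) / √(N ω) : ℝ)) - 1)
      (ν ω) := hint.sub (integrable_const _)
    have hlin' : Integrable (fun x => Complex.I * ((f x - u) / √(N ω) : ℝ)) (ν ω) :=
      Integrable.const_mul hlin.ofReal _
    have hsq' : Integrable (fun x => ((((f x - u) / √(N ω)) ^ 2 / 2 : ℝ) : ℂ)) (ν ω) :=
      hsq.ofReal
    have hint2 : Integrable (fun x => Complex.exp (Complex.I * ((f x - u) / √(N ω) : ℝ)) - 1 -
      Complex.I * ((f x - u) / √(N ω) : ℝ)) (ν ω) := hint1.sub hlin'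
    rw [integral_const_mul, integral_add hint2 hsq', integral_sub hint1 hlin',
      integral_sub hint (integrable_const _),
      integral_const_mul, integral_complex_ofReal, integral_complex_ofReal, hlin0,
      neg_div, ← hsqv]
    push_cast
    simp
    ring
  rw [dist_eq_norm, e, ← integral_const_mul]
  refine norm_integral_le_of_norm_le
    ((integrable_mul_min hpi (by fun_prop) (fun _ => by positivity) hs0.le).const_mul 3)
    (.of_forall fun x => ?_)
  rw [norm_mul, Complex.norm_natCast]
  refine (mul_le_mul_of_nonneg_left (norm_cexp_sub_one_sub_add_le _) h0.le).trans ?_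
  have hx : |f x - u| ≤ |f x| + 1 := (abs_sub _ _).trans (by gcongr)
  have hx2 : (f x - u) ^ 2 ≤ (|f x| + 1) ^ 2 := by
    rw [← sq_abs (f x - u)]
    gcongr
  rw [abs_div, abs_of_pos hs0, div_pow, hss]
  calc (N ω : ℝ) * (3 * ((f x - u) ^ 2 / N ω * min 1 (|f x - u| / √(N ω))))
      = 3 * ((f x - u) ^ 2 * min 1 (|f x - u| / √(N ω))) := by field_simp
    _ ≤ 3 * ((|f x| + 1) ^ 2 * min 1 ((|f x| + 1) / √(N ω))) := by gcongr

/-- Undoing the centring splits off the unimodular factor $e^{i\sqrt N\nu(f)}$. This phase need not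
converge, being the fluctuation inherited from the previous stage, so the result is phrased as a
difference tending to $0$. -/
theorem MeansTendsto.tendsto_pow_clt (h : MeansTendsto l ν μ) [IsProbabilityMeasure μ]
    (hν : ∀ᶠ ω in l, IsProbabilityMeasure (ν ω)) {N : Ω → ℕ} (hN : Tendsto N l atTop)
    {f : E → ℝ} (hfm : Measurable f) (hf : MemLp f 2 μ) (hf0 : ∫ x, f x ∂μ = 0) :
    Tendsto (fun ω => (∫ x, Complex.exp (Complex.I * (f x / √(N ω) : ℝ)) ∂ν ω) ^ N ω -
      Complex.exp (-(∫ x, f x ^ 2 ∂μ : ℝ) / 2) *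
        Complex.exp (Complex.I * (√(N ω) * ∫ x, f x ∂ν ω : ℝ))) l (𝓝 0) := by
  have h1 := h.tendsto_pow_clt_centered hν hN hfm hf hf0
  rw [tendsto_iff_norm_sub_tendsto_zero] at h1
  rw [tendsto_zero_iff_norm_tendsto_zero]
  refine h1.congr' ?_
  filter_upwards [hN.eventually_gt_atTop 0] with ω h0
  have h0 : 0 < (N ω : ℝ) := by exact_mod_cast h0
  have hs0 : 0 < √(N ω : ℝ) := Real.sqrt_pos.2 h0
  have hss : √(N ω : ℝ) ^ 2 = N ω := Real.sq_sqrt h0.le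
  set u := ∫ x, f x ∂ν ω
  have e1 : ∀ x, Complex.exp (Complex.I * (f x / √(N ω) : ℝ)) =
      Complex.exp (Complex.I * ((f x - u) / √(N ω) : ℝ)) *
        Complex.exp (Complex.I * (u / √(N ω) : ℝ)) := fun x => by
    rw [← Complex.exp_add, ← mul_add, ← Complex.ofReal_add, ← add_div, sub_add_cancel]
  have e2 : Complex.exp (Complex.I * (u / √(N ω) : ℝ)) ^ N ω =
      Complex.exp (Complex.I * (√(N ω) * u : ℝ)) := by
    rw [← Complex.exp_nat_mul, mul_left_comm]
    congr 2
    rw [← Complex.ofReal_natCast, ← Complex.ofReal_mul]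
    congr 1
    field_simp
    rw [hss, mul_comm]
  simp_rw [e1]
  rw [integral_mul_const, mul_pow, e2, ← sub_mul, norm_mul, Complex.norm_exp_I_mul_ofReal, mul_one]

end Means

/-! ### Integration against composed kernels and product measures -/

section Kernels

variable {α β : Type*} [MeasurableSpace α] [MeasurableSpace β]

theorem integral_comp_measure {F : Type*} [NormedAddCommGroup F] [NormedSpace ℝ F]
    {κ : Kernel α β} {μ : Measure α} {f : β → F} (hf : Integrable f (κ ∘ₘ μ)) :
    ∫ y, f y ∂(κ ∘ₘ μ) = ∫ x, ∫ y, f y ∂κ x ∂μ := by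
  rw [Measure.comp_eq_comp_const_apply] at hf ⊢
  rw [Kernel.integral_comp hf, Kernel.const_apply]

theorem lintegral_pi_prod {ι E : Type*} [Fintype ι] [MeasurableSpace E] {μ : Measure E}
    [IsProbabilityMeasure μ] {f : ι → E → ℝ≥0∞} (hf : ∀ i, Measurable (f i)) :
    ∫⁻ x : ι → E, ∏ i, f i (x i) ∂(Measure.pi fun _ => μ) = ∏ i, ∫⁻ x, f i x ∂μ := by
  have hind := iIndepFun_pi (μ := fun _ : ι => μ) (X := f) fun i => (hf i).aemeasurable
  have := lintegral_prod_eq_prod_lintegral_of_indepFun Finset.univ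
    (fun i (x : ι → E) => f i (x i)) hind fun i => (hf i).comp (measurable_pi_apply i)
  rw [this]
  refine Finset.prod_congr rfl fun i _ => ?_
  exact (measurePreserving_eval (fun _ : ι => μ) i).lintegral_comp (hf i)

/-- If an event is almost sure after a random step from every typical state, then it is typical
after the step. -/
theorem eventually_inProb_comp {ι : Type*} {Ω Ω' : ι → Type*} [∀ i, MeasurableSpace (Ω i)]
    [∀ i, MeasurableSpace (Ω' i)] {P : ∀ i, Measure (Ω i)} {P' : ∀ i, Measure (Ω' i)}
    {l : Filter ι} {κ : ∀ i, Kernel (Ω i) (Ω' i)} (hP : ∀ᶠ i in l, IsMarkovKernel (κ i) ∧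
      P' i = κ i ∘ₘ P i) {A : ∀ i, Set (Ω' i)} (hA : ∀ i, MeasurableSet (A i))
    (h : ∀ᶠ ω in inProb P l, κ ω.1 ω.2 (A ω.1)ᶜ = 0) :
    ∀ᶠ ω in inProb P' l, ω.2 ∈ A ω.1 := by
  rw [eventually_inProb] at h ⊢
  refine tendsto_of_tendsto_of_tendsto_of_le_of_le' tendsto_const_nhds h
    (.of_forall fun _ => zero_le) ?_
  filter_upwards [hP] with i hi
  obtain ⟨_, hi⟩ := hi
  have e : {x | ¬ x ∈ A i} = (A i)ᶜ := rfl
  rw [e, hi, Measure.bind_apply (hA i).compl (Kernel.aemeasurable _)]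
  have hm : MeasurableSet {x | ¬ κ i x (A i)ᶜ = 0} :=
    (Kernel.measurable_coe (κ i) (hA i).compl (measurableSet_singleton 0)).compl
  -- The conditional probability of failure is at most the indicator that it is nonzero.
  rw [← lintegral_indicator_one hm]
  refine lintegral_mono fun x => ?_
  by_cases hx : κ i x (A i)ᶜ = 0
  · simp [hx]
  · rw [Set.indicator_of_mem (by exact hx)]
    exact prob_le_one

end Kernels

/-! ### One stage of the algorithm as conditionally i.i.d. draws -/

namespace SMC

variable {E : Type*} [MeasurableSpace E]

theorem measurable_markovOp {f : E → ℝ} (K : Kernel E E) (hf : Measurable f) :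
    Measurable (markovOp K f) :=
  hf.stronglyMeasurable.integral_kernel.measurable

theorem measurable_densityOp {g : E → ℝ≥0} (hg : Measurable g) {f : E → ℝ} (hf : Measurable f) :
    Measurable (densityOp g f) := by
  unfold densityOp
  fun_prop

theorem measurable_empiricalMean {N : ℕ} {f : E → ℝ} (hf : Measurable f) :
    Measurable (empiricalMean f : (Fin N → E) → ℝ) := by
  unfold empiricalMean
  fun_prop

section Step

variable {N : ℕ} {g : E → ℝ≥0} (hg : Measurable g) (K : Kernel E E)

instance [NeZero N] : IsMarkovKernel (resampleDist N g hg) := isMarkovKernel_resampleDist 0 g hg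

/-- The conditional law of one particle after resampling and mutation. -/
noncomputable def selectMutate (N : ℕ) {g : E → ℝ≥0} (hg : Measurable g) (K : Kernel E E) :
    Kernel (Fin N → E) E := K ∘ₖ resampleDist N g hg

instance [NeZero N] [IsMarkovKernel K] : IsMarkovKernel (selectMutate N hg K) := by
  unfold selectMutate
  infer_instance

/-- One stage of the algorithm: independent draws from the selection and mutation kernel. -/
noncomputable def particleStep (N : ℕ) [NeZero N] {g : E → ℝ≥0} (hg : Measurable g) (K : Kernel E E)
    [IsMarkovKernel K] : Kernel (Fin N → E) (Fin N → E) :=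
  piKernel fun _ : Fin N => selectMutate N hg K

instance [NeZero N] [IsMarkovKernel K] : IsMarkovKernel (particleStep N hg K) := by
  unfold particleStep
  infer_instance

theorem particleStep_apply [NeZero N] [IsMarkovKernel K] (x : Fin N → E) :
    particleStep N hg K x = Measure.pi fun _ => selectMutate N hg K x := rfl

/-- On rectangles the mutation probability is a product, which integrates coordinatewise. Hence
resampling followed by mutation is again sampling from a product of identical laws. -/
theorem mutateKernel_comp_pi [IsMarkovKernel K] (ρ : Measure E) [IsProbabilityMeasure ρ] :
    mutateKernel N K ∘ₘ (Measure.pi fun _ => ρ) = Measure.pi fun _ : Fin N => K ∘ₘ ρ := by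
  refine (Measure.pi_eq fun s hs => ?_).symm
  rw [Measure.bind_apply (MeasurableSet.univ_pi hs) (Kernel.aemeasurable _)]
  have : ∀ x : Fin N → E, mutateKernel N K x (Set.univ.pi s) = ∏ i, K (x i) (s i) := fun x => by
    change Measure.pi (fun i => K (x i)) (Set.univ.pi s) = _
    rw [Measure.pi_pi]
  simp_rw [this]
  rw [lintegral_pi_prod (f := fun i y => K y (s i)) fun i => Kernel.measurable_coe K (hs i)]
  refine Finset.prod_congr rfl fun i _ => ?_
  rw [Measure.bind_apply (hs i) (Kernel.aemeasurable _)]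

theorem particleLaw_succ [NeZero N] {μ₀ : Measure E} {g : ℕ → E → ℝ≥0}
    (hg : ∀ k, Measurable (g k)) (K : ℕ → Kernel E E) [∀ k, IsMarkovKernel (K k)] (k : ℕ) :
    particleLaw μ₀ g hg K N (k + 1) =
      particleStep N (hg k) (K (k + 1)) ∘ₘ particleLaw μ₀ g hg K N k := by
  rw [particleLaw, Measure.bind_bind (Kernel.aemeasurable _) (Kernel.aemeasurable _)]
  congr 1
  ext1 x
  rw [particleStep_apply, selectMutate, Kernel.comp_apply]
  exact mutateKernel_comp_pi (K (k + 1)) (resampleDist N (g k) (hg k) x)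

theorem selectMutate_apply (x : Fin N → E) :
    selectMutate N hg K x = ∑ i, (resampleWeight g x i : ℝ≥0∞) • K (x i) := by
  ext s hs
  rw [selectMutate, Kernel.comp_apply, Measure.bind_apply hs (Kernel.aemeasurable _)]
  change ∫⁻ a, K a s ∂(∑ i, (resampleWeight g x i : ℝ≥0∞) • Measure.dirac (x i)) = _
  rw [lintegral_finsetSum_measure]
  simp only [lintegral_smul_measure, lintegral_dirac' _ (Kernel.measurable_coe K hs),
    Measure.coe_finsetSum, Finset.sum_apply, Measure.smul_apply]

/-- The factors $1/N$ cancel in the self-normalised ratio. Particles of weight zero contribute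
nothing, so integrability matters only where $g\ne0$. -/
theorem integral_selectMutate {x : Fin N → E} (hx : empiricalMean (fun y => (g y : ℝ)) x ≠ 0)
    {f : E → ℝ} (hf : ∀ i, g (x i) ≠ 0 → Integrable f (K (x i))) :
    Integrable f (selectMutate N hg K x) ∧
      ∫ y, f y ∂(selectMutate N hg K x) =
        empiricalMean (densityOp g (markovOp K f)) x / empiricalMean (fun y => (g y : ℝ)) x := by
  have hs : ∑ j, g (x j) ≠ 0 := fun h => hx (by
    unfold empiricalMean
    rw [← NNReal.coe_sum, h]
    simp)
  have hN : (N : ℝ) ≠ 0 := fun h => hx (by simp [empiricalMean, h])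
  have hw : ∀ i, resampleWeight g x i = g (x i) / ∑ j, g (x j) := fun i => by
    rw [resampleWeight, if_neg hs]
  have hi : ∀ i, Integrable f ((resampleWeight g x i : ℝ≥0∞) • K (x i)) := fun i => by
    by_cases h0 : g (x i) = 0
    · simp [hw, h0]
    · exact (hf i h0).smul_measure ENNReal.coe_ne_top
  rw [selectMutate_apply]
  refine ⟨integrable_finsetSum_measure.2 fun i _ => hi i, ?_⟩
  rw [integral_finsetSum_measure fun i _ => hi i]
  simp only [integral_smul_measure, ENNReal.coe_toReal, hw, empiricalMean, densityOp, markovOp]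
  rw [mul_div_mul_left _ _ (inv_ne_zero hN), Finset.sum_div]
  refine Finset.sum_congr rfl fun i _ => ?_
  push_cast
  rw [smul_eq_mul]
  ring

end Step

/-! ### Convergence of the conditional laws -/

section Limits

/-- The law of large numbers in probability for the empirical measures of particle systems. -/
def EmpiricalLLN (P : ∀ N, Measure (Fin N → E)) (μ : Measure E) : Prop :=
  ∀ f : E → ℝ, Measurable f → Integrable f μ →
    Tendsto (fun ω : Σ N, Fin N → E => empiricalMean f ω.2) (inProb P atTop) (𝓝 (∫ x, f x ∂μ))

/-- With probability tending to `1`, no particle lies in a given `μ`-null set. -/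
def AvoidsNull (P : ∀ N, Measure (Fin N → E)) (μ : Measure E) : Prop :=
  ∀ B, MeasurableSet B → μ B = 0 → ∀ᶠ ω in inProb P atTop, ∀ i, ω.2 i ∉ B

/-- The central limit theorem with asymptotic variance `V` for centred square integrable
functions, in terms of characteristic functions. -/
def EmpiricalCLT (P : ∀ N, Measure (Fin N → E)) (μ : Measure E) (V : (E → ℝ) → ℝ) : Prop :=
  ∀ f : E → ℝ, Measurable f → MemLp f 2 μ → ∫ x, f x ∂μ = 0 → ∀ t : ℝ,
    Tendsto (fun N => ∫ x, Complex.exp (t * (√(N : ℝ) * empiricalMean f x : ℝ) * Complex.I) ∂(P N))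
      atTop (𝓝 (Complex.exp (-(t ^ 2 * V f : ℝ) / 2)))

variable {P : ∀ N, Measure (Fin N → E)} {μ μ' : Measure E} {g : E → ℝ≥0} {K : Kernel E E}

theorem integral_withDensity_coe {g : E → ℝ≥0} (hg : Measurable g)
    (hμ' : μ' = μ.withDensity fun x => (g x : ℝ≥0∞)) (f : E → ℝ) :
    ∫ x, f x ∂μ' = ∫ x, densityOp g f x ∂μ := by
  rw [hμ', integral_withDensity_eq_integral_smul hg]
  rfl

theorem integrable_withDensity_coe {g : E → ℝ≥0} (hg : Measurable g)
    (hμ' : μ' = μ.withDensity fun x => (g x : ℝ≥0∞)) {f : E → ℝ} :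
    Integrable f μ' ↔ Integrable (densityOp g f) μ := by
  rw [hμ', integrable_withDensity_iff_integrable_smul hg]
  rfl

theorem ae_withDensity_coe {g : E → ℝ≥0} (hg : Measurable g)
    (hμ' : μ' = μ.withDensity fun x => (g x : ℝ≥0∞)) {p : E → Prop} (h : ∀ᵐ x ∂μ', p x) :
    ∀ᵐ x ∂μ, g x ≠ 0 → p x := by
  rw [hμ', ae_withDensity_iff hg.coe_nnreal_ennreal] at h
  filter_upwards [h] with x hx h0
  exact hx (by simpa using h0)

theorem EmpiricalLLN.tendsto_density [IsProbabilityMeasure μ'] (h : EmpiricalLLN P μ)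
    (hg : Measurable g) (hμ' : μ' = μ.withDensity fun x => (g x : ℝ≥0∞)) :
    Tendsto (fun ω : Σ N, Fin N → E => empiricalMean (fun y => (g y : ℝ)) ω.2)
      (inProb P atTop) (𝓝 1) := by
  have h1 : ∫ x, (g x : ℝ) ∂μ = 1 := by
    simpa [densityOp] using (integral_withDensity_coe hg hμ' fun _ => (1 : ℝ)).symm
  rw [← h1]
  refine h _ (by fun_prop) ?_
  have h2 := (integrable_withDensity_coe hg hμ').1 (integrable_const (1 : ℝ))
  unfold densityOp at h2
  simpa only [mul_one] using h2

theorem integrable_markovOp (hK : K.Invariant μ') {f : E → ℝ}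
    (hfm : Measurable f) (hf : Integrable f μ') : (∀ᵐ x ∂μ', Integrable f (K x)) ∧ Integrable (markovOp K f) μ' ∧
      ∫ x, markovOp K f x ∂μ' = ∫ x, f x ∂μ' := by
  have hf' : Integrable f (K ∘ₘ μ') := by rwa [show K ∘ₘ μ' = μ' from hK]
  refine ⟨Measure.ae_integrable_of_integrable_comp hf', ?_, ?_⟩
  · have := Measure.integrable_integral_norm_of_integrable_comp hf'
    refine this.mono (measurable_markovOp K hfm).aestronglyMeasurable (.of_forall fun x => ?_)
    exact (norm_integral_le_integral_norm _).trans (le_abs_self _)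
  · unfold markovOp
    rw [← integral_comp_measure hf', show K ∘ₘ μ' = μ' from hK]

/-- After reweighting and mutation the conditional laws of the particles converge. -/
theorem EmpiricalLLN.eventually_selectMutate [IsMarkovKernel K] [IsProbabilityMeasure μ']
    (h : EmpiricalLLN P μ) (hn : AvoidsNull P μ) (hg : Measurable g)
    (hμ' : μ' = μ.withDensity fun x => (g x : ℝ≥0∞)) (hK : K.Invariant μ') {f : E → ℝ}
    (hfm : Measurable f) (hf : Integrable f μ') :
    ∀ᶠ ω in inProb P atTop, Integrable f (selectMutate ω.1 hg K ω.2) ∧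
      ∫ y, f y ∂(selectMutate ω.1 hg K ω.2) =
        empiricalMean (densityOp g (markovOp K f)) ω.2 /
          empiricalMean (fun y => (g y : ℝ)) ω.2 := by
  have hms : MeasurableSet {x | Integrable f (K x)} :=
    ProbabilityTheory.measurableSet_integrable hfm.stronglyMeasurable
  -- This set is `μ`-null: `f` is integrable under `K x` for `μ'`-almost every `x`, and `μ'` has
  -- density `g`. So with high probability every particle avoids it.
  have hB : MeasurableSet {x | ¬ (g x ≠ 0 → Integrable f (K x))} := by
    have : {x | ¬ (g x ≠ 0 → Integrable f (K x))} =
        (g ⁻¹' {0})ᶜ ∩ {x | Integrable f (K x)}ᶜ := by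
      ext x
      simp
    rw [this]
    exact (hg (measurableSet_singleton 0)).compl.inter hms.compl
  filter_upwards [hn _ hB (ae_withDensity_coe hg hμ' (integrable_markovOp hK hfm hf).1),
    (h.tendsto_density hg hμ').eventually_ne one_ne_zero] with ω h1 h2
  exact integral_selectMutate hg K h2 fun i => by simpa using h1 i

/-- The numerator tends to $\mu(gKf)=\mu'(Kf)=\mu'(f)$ and the normalisation to $\mu(g)=1$. -/
theorem EmpiricalLLN.meansTendsto [IsMarkovKernel K] [IsProbabilityMeasure μ']
    (h : EmpiricalLLN P μ) (hn : AvoidsNull P μ) (hg : Measurable g)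
    (hμ' : μ' = μ.withDensity fun x => (g x : ℝ≥0∞)) (hK : K.Invariant μ') :
    MeansTendsto (inProb P atTop) (fun ω => selectMutate ω.1 hg K ω.2) μ' := by
  intro f hfm hf
  have hev := h.eventually_selectMutate hn hg hμ' hK hfm hf
  refine ⟨hev.mono fun ω hω => hω.1, ?_⟩
  obtain ⟨-, h1, h2⟩ := integrable_markovOp hK hfm hf
  have h3 := (h _ (measurable_densityOp hg (measurable_markovOp K hfm))
    ((integrable_withDensity_coe hg hμ').1 h1)).div (h.tendsto_density hg hμ') one_ne_zero
  rw [← integral_withDensity_coe hg hμ', h2, div_one] at h3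
  exact h3.congr' (hev.mono fun ω hω => hω.2.symm)

end Limits

/-- Independence factorises the characteristic function. The scaling is $c=1$ for the law of large
numbers and $c=\sqrt N$ for the central limit theorem. -/
theorem integral_pi_cexp_empiricalMean {N : ℕ} (ρ : Measure E) [IsProbabilityMeasure ρ]
    (f : E → ℝ) (t c : ℝ) :
    ∫ x : Fin N → E, Complex.exp (t * (c * empiricalMean f x : ℝ) * Complex.I)
        ∂(Measure.pi fun _ => ρ) =
      (∫ y, Complex.exp (Complex.I * (t * f y * (c / N) : ℝ)) ∂ρ) ^ N := by
  have := integral_fintype_prod_eq_pow (ι := Fin N) (μ := ρ)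
    (fun y => Complex.exp (Complex.I * (t * f y * (c / N) : ℝ)))
  rw [Fintype.card_fin] at this
  rw [← this]
  refine integral_congr_ae (.of_forall fun x => ?_)
  dsimp only
  rw [← Complex.exp_sum, ← Finset.mul_sum, ← Complex.ofReal_sum, ← Complex.ofReal_mul, mul_comm]
  congr 3
  rw [← Finset.sum_mul, ← Finset.mul_sum, empiricalMean]
  ring

theorem mul_div_natCast (t a : ℝ) (N : ℕ) : t * a / N = t * a * (1 / N) := by ring

theorem div_sqrt_natCast_eq_mul (a : ℝ) (N : ℕ) : a / √(N : ℝ) = a * (√(N : ℝ) / N) := by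
  rw [Real.sqrt_div_self']
  ring

/-! ### Base case: independent particles -/

section Initial

theorem meansTendsto_const (μ : Measure E) {Ω : Type*} (l : Filter Ω) : MeansTendsto l (fun _ => μ) μ :=
  fun _ _ hf => ⟨.of_forall fun _ => hf, tendsto_const_nhds⟩

variable (μ : Measure E) [IsProbabilityMeasure μ]

theorem empiricalLLN_pi : EmpiricalLLN (fun N => Measure.pi fun _ : Fin N => μ) μ := by
  intro f hfm hf
  refine tendsto_inProb_of_charFun (X := fun N (x : Fin N → E) => empiricalMean f x)
    (fun N => measurable_empiricalMean hfm) fun t => ?_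
  have h := (meansTendsto_const μ atTop).tendsto_pow_lln (.of_forall fun _ => inferInstance)
    tendsto_id (f := fun y => t * f y) (by fun_prop) (hf.const_mul t)
  simp only [integral_const_mul, id_eq, mul_div_natCast] at h
  simp_rw [← integral_pi_cexp_empiricalMean] at h
  simpa [mul_comm, mul_left_comm, mul_assoc] using h

theorem avoidsNull_pi : AvoidsNull (fun N => Measure.pi fun _ : Fin N => μ) μ := by
  intro B _ hB0
  rw [eventually_inProb]
  refine tendsto_const_nhds.congr fun N => (?_ : (0 : ℝ≥0∞) = _)
  have : {x : Fin N → E | ¬ ∀ i, x i ∉ B} = ⋃ i, Function.eval i ⁻¹' B := by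
    ext x
    simp
  rw [this, eq_comm, measure_iUnion_null_iff]
  exact fun i => Measure.pi_eval_preimage_null _ hB0

theorem empiricalCLT_pi :
    EmpiricalCLT (fun N => Measure.pi fun _ : Fin N => μ) μ (fun f => ∫ x, f x ^ 2 ∂μ) := by
  intro f hfm hf hf0 t
  have h := (meansTendsto_const μ atTop).tendsto_pow_clt (.of_forall fun _ => inferInstance)
    tendsto_id (f := fun y => t * f y) (by fun_prop) (hf.const_mul t)
    (by rw [integral_const_mul, hf0, mul_zero])
  simp only [integral_const_mul, id_eq, div_sqrt_natCast_eq_mul, hf0, mul_zero, mul_pow,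
    Complex.ofReal_zero, Complex.exp_zero, mul_one] at h
  simp_rw [← integral_pi_cexp_empiricalMean] at h
  have h2 := h.add_const (Complex.exp (-(t ^ 2 * ∫ x, f x ^ 2 ∂μ : ℝ) / 2))
  simpa only [sub_add_cancel, zero_add] using h2

end Initial

/-! ### Induction step: passing the limit theorems through one stage -/

section Induction

variable {P P' : ∀ N, Measure (Fin N → E)} {μ μ' : Measure E} {g : E → ℝ≥0} {K : Kernel E E}

theorem integrable_cexp_mul_I {α : Type*} [MeasurableSpace α] (m : Measure α)
    [IsFiniteMeasure m] (t : ℝ) {Y : α → ℝ} (hY : Measurable Y) :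
    Integrable (fun x => Complex.exp (t * Y x * Complex.I)) m :=
  Integrable.of_bound (by fun_prop) 1 (.of_forall fun x => by
    rw [← Complex.ofReal_mul, Complex.norm_exp_ofReal_mul_I])

theorem integral_step_cexp [IsMarkovKernel K] [∀ N, IsProbabilityMeasure (P' N)] {N : ℕ} [NeZero N]
     (hg : Measurable g)
    (hP' : P' N = particleStep N hg K ∘ₘ P N) {f : E → ℝ} (hf : Measurable f) (t c : ℝ) :
    ∫ x, Complex.exp (t * (c * empiricalMean f x : ℝ) * Complex.I) ∂(P' N) =
      ∫ x, (∫ y, Complex.exp (Complex.I * (t * f y * (c / N) : ℝ))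
        ∂(selectMutate N hg K x)) ^ N ∂(P N) := by
  have hm : Measurable fun x : Fin N → E => c * empiricalMean f x :=
    (measurable_empiricalMean hf).const_mul c
  have hi := integrable_cexp_mul_I (P' N) t hm
  rw [hP'] at hi ⊢
  rw [integral_comp_measure hi]
  simp_rw [particleStep_apply, integral_pi_cexp_empiricalMean]

theorem tendsto_fst_nat : Tendsto (fun ω : Σ N, Fin N → E => ω.1) (inProb P atTop) atTop :=
  tendsto_fst_inProb

theorem eventually_isProbabilityMeasure_selectMutate [IsMarkovKernel K] (hg : Measurable g) :
    ∀ᶠ ω in inProb P atTop, IsProbabilityMeasure (selectMutate ω.1 hg K ω.2) := by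
  filter_upwards [tendsto_fst_nat.eventually_gt_atTop 0] with ω hω
  have : NeZero ω.1 := ⟨hω.ne'⟩
  infer_instance

theorem stronglyMeasurable_integral_cexp_pow {N : ℕ} (hg : Measurable g) {f : E → ℝ}
    (hf : Measurable f) : StronglyMeasurable fun x : Fin N → E =>
      (∫ y, Complex.exp (Complex.I * f y) ∂(selectMutate N hg K x)) ^ N := by
  refine StronglyMeasurable.pow (StronglyMeasurable.integral_kernel ?_) N
  exact Measurable.stronglyMeasurable (by fun_prop)

theorem norm_integral_cexp_pow_le [IsMarkovKernel K] {N : ℕ} (hg : Measurable g) (f : E → ℝ) (x : Fin N → E) :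
    ‖(∫ y, Complex.exp (Complex.I * f y) ∂(selectMutate N hg K x)) ^ N‖ ≤ 1 := by
  rcases Nat.eq_zero_or_pos N with rfl | hN
  · simp
  · have : NeZero N := ⟨hN.ne'⟩
    rw [norm_pow]
    exact pow_le_one₀ (norm_nonneg _) (norm_integral_cexp_I_mul_le _ _)

/-- Invariance turns $\mu'(B)=0$ into $K(x,B)=0$ for $\mu$-almost every $x$ with $g(x)\ne0$. The
current particles avoid the exceptional points, and the weak law rules out vanishing total weight,
so a draw hits $B$ with conditional probability zero. -/
theorem AvoidsNull.step [IsMarkovKernel K] [IsProbabilityMeasure μ']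
    (h : EmpiricalLLN P μ) (hn : AvoidsNull P μ)
    (hg : Measurable g) (hμ' : μ' = μ.withDensity fun x => (g x : ℝ≥0∞)) (hK : K.Invariant μ')
    (hP' : ∀ N [NeZero N], P' N = particleStep N hg K ∘ₘ P N) : AvoidsNull P' μ' := by
  intro B hB hB0
  have hm : ∀ N, MeasurableSet {x : Fin N → E | ∀ i, x i ∉ B} := fun N => by
    simp only [Set.ofPred_forall]
    exact MeasurableSet.iInter fun i => (measurable_pi_apply i hB).compl
  classical
  -- The stage kernel is Markov only for `N ≠ 0`; the zero kernel is a filler at `N = 0`, irrelevant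
  -- in the limit.
  let κ : ∀ N, Kernel (Fin N → E) (Fin N → E) := fun N =>
    if hN : N = 0 then 0 else haveI : NeZero N := ⟨hN⟩; particleStep N hg K
  have hκ : ∀ N [NeZero N], κ N = particleStep N hg K := fun N hN => by
    simp only [κ]
    rw [dif_neg hN.out]
  refine eventually_inProb_comp (P := P) (κ := κ) (A := fun N => {x | ∀ i, x i ∉ B}) ?_ hm ?_
  · filter_upwards [eventually_gt_atTop 0] with N hN
    have : NeZero N := ⟨hN.ne'⟩
    rw [hκ]
    exact ⟨inferInstance, hP' N⟩
  have hKB : ∀ᵐ x ∂μ', K x B = 0 := by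
    have : μ' B = ∫⁻ x, K x B ∂μ' := by
      conv_lhs => rw [← show K ∘ₘ μ' = μ' from hK]
      rw [Measure.bind_apply hB (Kernel.aemeasurable _)]
    rw [hB0, eq_comm, lintegral_eq_zero_iff (Kernel.measurable_coe K hB)] at this
    exact this
  have hms : MeasurableSet {x | ¬ (g x ≠ 0 → K x B = 0)} := by
    have : {x | ¬ (g x ≠ 0 → K x B = 0)} = (g ⁻¹' {0})ᶜ ∩ ((fun x => K x B) ⁻¹' {0})ᶜ := by
      ext x
      simp
    rw [this]
    exact (hg (measurableSet_singleton 0)).compl.inter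
      (Kernel.measurable_coe K hB (measurableSet_singleton 0)).compl
  filter_upwards [hn _ hms (ae_withDensity_coe hg hμ' hKB),
    (h.tendsto_density hg hμ').eventually_ne one_ne_zero,
    tendsto_fst_nat.eventually_gt_atTop 0] with ω h1 h2 h0
  have : NeZero ω.1 := ⟨h0.ne'⟩
  rw [hκ, particleStep_apply]
  have he : {x : Fin ω.1 → E | ∀ i, x i ∉ B}ᶜ = ⋃ i, Function.eval i ⁻¹' B := by
    ext x
    simp
  rw [he, measure_iUnion_null_iff]
  refine fun i => Measure.pi_eval_preimage_null _ ?_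
  have hs : ∑ j, g (ω.2 j) ≠ 0 := fun h => h2 (by
    unfold empiricalMean
    rw [← NNReal.coe_sum, h]
    simp)
  rw [selectMutate_apply]
  simp only [Measure.coe_finsetSum, Finset.sum_apply, Measure.smul_apply, smul_eq_mul]
  refine Finset.sum_eq_zero fun j _ => ?_
  by_cases hj : g (ω.2 j) = 0
  · simp [resampleWeight, hs, hj]
  · have : K (ω.2 j) B = 0 := by simpa [hj] using h1 j
    rw [this, mul_zero]

/-- The conditional characteristic functions tend in probability to the constant $e^{it\mu'(f)}$ and
are bounded by one, so their expectations converge; a constant limit law gives convergence in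
probability. -/
theorem EmpiricalLLN.step [IsMarkovKernel K] [∀ N, IsProbabilityMeasure (P N)]
    [∀ N, IsProbabilityMeasure (P' N)] [IsProbabilityMeasure μ']
    (h : EmpiricalLLN P μ) (hn : AvoidsNull P μ)
    (hg : Measurable g) (hμ' : μ' = μ.withDensity fun x => (g x : ℝ≥0∞)) (hK : K.Invariant μ')
    (hP' : ∀ N [NeZero N], P' N = particleStep N hg K ∘ₘ P N) : EmpiricalLLN P' μ' := by
  intro f hfm hf
  refine tendsto_inProb_of_charFun (X := fun N (x : Fin N → E) => empiricalMean f x)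
    (fun N => measurable_empiricalMean hfm) fun t => ?_
  have h1 := (h.meansTendsto hn hg hμ' hK).tendsto_pow_lln
    (eventually_isProbabilityMeasure_selectMutate hg) tendsto_fst_nat (f := fun y => t * f y)
    (by fun_prop) (hf.const_mul t)
  simp only [integral_const_mul, mul_div_natCast] at h1
  set L : ℂ := Complex.exp (Complex.I * (t * ∫ x, f x ∂μ' : ℝ)) with hL
  have h2 := tendsto_integral_of_inProb (P := P) (l := atTop) (C := 1 + ‖L‖)
    (F := fun N x => (∫ y, Complex.exp (Complex.I * (t * f y * (1 / N) : ℝ))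
        ∂(selectMutate N hg K x)) ^ N - L)
    (fun N x => (norm_sub_le _ _).trans (add_le_add_left (norm_integral_cexp_pow_le hg _ _) _))
    (by simpa using h1.sub_const L)
  have h3 := h2.add_const L
  rw [zero_add] at h3
  have hLe : Complex.exp (t * (∫ x, f x ∂μ' : ℝ) * Complex.I) = L := by
    rw [hL, Complex.ofReal_mul, mul_comm Complex.I]
  rw [hLe]
  refine h3.congr' ?_
  filter_upwards [eventually_gt_atTop 0] with N hN
  have : NeZero N := ⟨hN.ne'⟩
  have h4 := integral_step_cexp hg (hP' N) hfm t 1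
  simp only [one_mul] at h4
  rw [h4, integral_sub _ (integrable_const _)]
  · simp
  · exact Integrable.of_bound (stronglyMeasurable_integral_cexp_pow (f := fun y => t * f y * (1 / N))
      hg (by fun_prop)).aestronglyMeasurable 1
      (.of_forall fun x => norm_integral_cexp_pow_le hg _ x)

theorem norm_cexp_sub_cexp_le (a b : ℝ) :
    ‖Complex.exp (Complex.I * a) - Complex.exp (Complex.I * b)‖ ≤ |a - b| := by
  have : Complex.exp (Complex.I * a) - Complex.exp (Complex.I * b) =
      Complex.exp (Complex.I * b) * (Complex.exp (Complex.I * (a - b : ℝ)) - 1) := by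
    rw [mul_sub, ← Complex.exp_add, mul_one, ← mul_add, ← Complex.ofReal_add]
    congr 4
    ring
  rw [this, norm_mul, Complex.norm_exp_I_mul_ofReal, one_mul]
  exact Real.norm_exp_I_mul_ofReal_sub_one_le

/-- The fresh sampling noise contributes $\mu'(f^2)$ and the inherited fluctuation $V(Qf)$. They add
because the conditional Gaussian factor is asymptotically deterministic. -/
theorem EmpiricalCLT.step [IsMarkovKernel K] [∀ N, IsProbabilityMeasure (P N)]
    [∀ N, IsProbabilityMeasure (P' N)] [IsProbabilityMeasure μ']
    {V : (E → ℝ) → ℝ} (hV : EmpiricalCLT P μ V)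
    (h : EmpiricalLLN P μ) (hn : AvoidsNull P μ)
    (hg : Measurable g) (hμ' : μ' = μ.withDensity fun x => (g x : ℝ≥0∞)) (hK : K.Invariant μ')
    (hQ : ∀ f, Measurable f → MemLp f 2 μ' → MemLp (densityOp g (markovOp K f)) 2 μ)
    (hP' : ∀ N [NeZero N], P' N = particleStep N hg K ∘ₘ P N) :
    EmpiricalCLT P' μ' fun f => V (densityOp g (markovOp K f)) + ∫ x, f x ^ 2 ∂μ' := by
  intro f hfm hf hf0 t
  have hf1 : Integrable f μ' := hf.integrable one_le_two
  set Q := densityOp g (markovOp K f) with hQdef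
  have hQm : Measurable Q := measurable_densityOp hg (measurable_markovOp K hfm)
  obtain ⟨-, -, hKf⟩ := integrable_markovOp hK hfm hf1
  have hQ0 : ∫ x, Q x ∂μ = 0 := by rw [← integral_withDensity_coe hg hμ', hKf, hf0]
  have hclt := hV Q hQm (hQ f hfm hf) hQ0
  have hYm : ∀ N, Measurable fun x : Fin N → E => √(N : ℝ) * empiricalMean Q x := fun N =>
    (measurable_empiricalMean hQm).const_mul _
  have h1 := (h.meansTendsto hn hg hμ' hK).tendsto_pow_clt
    (eventually_isProbabilityMeasure_selectMutate hg) tendsto_fst_nat (f := fun y => t * f y)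
    (by fun_prop) (hf.const_mul t) (by rw [integral_const_mul, hf0, mul_zero])
  simp only [integral_const_mul, div_sqrt_natCast_eq_mul, mul_pow] at h1
  set L : ℂ := Complex.exp (-(t ^ 2 * ∫ x, f x ^ 2 ∂μ' : ℝ) / 2) with hL
  -- The phases differ by at most $|\sqrt N\mu^N(Qf)|\cdot|t|\,|1/\mu^N(g)-1|$: a tight sequence, by
  -- the assumed central limit theorem, times one tending to `0`.
  have hslutsky : Tendsto (fun ω : Σ N, Fin N → E =>
      Complex.exp (Complex.I * (√(ω.1 : ℝ) * (t * ∫ x, f x ∂(selectMutate ω.1 hg K ω.2)) : ℝ)) -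
        Complex.exp (Complex.I * (t * (√(ω.1 : ℝ) * empiricalMean Q ω.2) : ℝ)))
      (inProb P atTop) (𝓝 0) := by
    have hδ : Tendsto (fun ω : Σ N, Fin N → E =>
        t * ((empiricalMean (fun y => (g y : ℝ)) ω.2)⁻¹ - 1)) (inProb P atTop) (𝓝 0) := by
      simpa using (((h.tendsto_density hg hμ').inv₀ one_ne_zero).sub_const 1).const_mul t
    have hmul := (tendsto_mul_of_charFun hYm
      (f := fun t : ℝ => Complex.exp (-(t ^ 2 * V Q : ℝ) / 2)) (by fun_prop) hclt hδ).abs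
    rw [abs_zero] at hmul
    refine squeeze_zero_norm' ?_ hmul
    filter_upwards [h.eventually_selectMutate hn hg hμ' hK hfm hf1] with ω hω
    refine (norm_cexp_sub_cexp_le _ _).trans (le_of_eq ?_)
    rw [hω.2, ← hQdef]
    congr 1
    ring
  have h2 : Tendsto (fun ω : Σ N, Fin N → E =>
      (∫ y, Complex.exp (Complex.I * (t * f y * (√(ω.1 : ℝ) / ω.1) : ℝ))
        ∂(selectMutate ω.1 hg K ω.2)) ^ ω.1 -
        L * Complex.exp (t * (√(ω.1 : ℝ) * empiricalMean Q ω.2 : ℝ) * Complex.I))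
      (inProb P atTop) (𝓝 0) := by
    have h3 := h1.add (hslutsky.const_mul L)
    rw [mul_zero, add_zero] at h3
    refine h3.congr fun ω => ?_
    rw [mul_comm _ Complex.I, ← Complex.ofReal_mul]
    ring
  have h3 := tendsto_integral_of_inProb (P := P) (l := atTop) (C := 1 + ‖L‖)
    (F := fun N x => (∫ y, Complex.exp (Complex.I * (t * f y * (√(N : ℝ) / N) : ℝ))
        ∂(selectMutate N hg K x)) ^ N -
        L * Complex.exp (t * (√(N : ℝ) * empiricalMean Q x : ℝ) * Complex.I))
    (fun N x => (norm_sub_le _ _).trans (add_le_add (norm_integral_cexp_pow_le hg _ _) (by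
      rw [norm_mul, ← Complex.ofReal_mul, Complex.norm_exp_ofReal_mul_I, mul_one]))) h2
  have h4 := h3.add ((hclt t).const_mul L)
  rw [zero_add, hL, ← Complex.exp_add, ← hL] at h4
  have e : (-(t ^ 2 * ∫ x, f x ^ 2 ∂μ' : ℝ) / 2 + -(t ^ 2 * V Q : ℝ) / 2 : ℂ) =
      -(t ^ 2 * (V Q + ∫ x, f x ^ 2 ∂μ') : ℝ) / 2 := by
    push_cast
    ring
  rw [e] at h4
  refine h4.congr' ?_
  filter_upwards [eventually_gt_atTop 0] with N hN
  have : NeZero N := ⟨hN.ne'⟩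
  rw [integral_step_cexp hg (hP' N) hfm t _, integral_sub _
    ((integrable_cexp_mul_I (P N) t (hYm N)).const_mul L), integral_const_mul, sub_add_cancel]
  exact Integrable.of_bound (stronglyMeasurable_integral_cexp_pow
    (f := fun y => t * f y * (√(N : ℝ) / N)) hg (by fun_prop)).aestronglyMeasurable 1
    (.of_forall fun x => norm_integral_cexp_pow_le hg _ x)

end Induction

end SMC

/-! ### $L^2$ estimates for the Markov and density operators -/

theorem eLpNorm_two_sq {α : Type*} [MeasurableSpace α] (f : α → ℝ) (μ : Measure α) :
    eLpNorm f 2 μ ^ 2 = ∫⁻ x, ‖f x‖ₑ ^ 2 ∂μ := by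
  have := eLpNorm_nnreal_pow_eq_lintegral (μ := μ) (f := f) (p := 2) two_ne_zero
  simpa using this

theorem eLpNorm_two_sq_eq_ofReal {α : Type*} [MeasurableSpace α] {f : α → ℝ} {μ : Measure α}
    (hf : MemLp f 2 μ) : eLpNorm f 2 μ ^ 2 = ENNReal.ofReal (∫ x, f x ^ 2 ∂μ) := by
  rw [eLpNorm_two_sq, ofReal_integral_eq_lintegral_ofReal hf.integrable_sq
    (.of_forall fun x => sq_nonneg _)]
  refine lintegral_congr fun x => ?_
  rw [← sq_abs, ENNReal.ofReal_pow (abs_nonneg _), ← Real.norm_eq_abs, ofReal_norm]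

namespace SMC

theorem coe_le_maxDensity {E : Type*} {g : ℕ → E → ℝ≥0} {n k : ℕ} (hk : k < n) (x : E) : (g k x : ℝ≥0∞) ≤ maxDensity g n :=
  (le_iSup (fun x => (g k x : ℝ≥0∞)) x).trans
    (le_iSup₂ (f := fun k (_ : k ∈ Finset.range n) => ⨆ x, (g k x : ℝ≥0∞)) k
      (Finset.mem_range.2 hk))

variable {E : Type*} [MeasurableSpace E]

section L2

variable {μ μ' : Measure E} {g : E → ℝ≥0} {K : Kernel E E}

theorem markovOp_congr (hK : K.Invariant μ') {f f' : E → ℝ} (h : f =ᵐ[μ'] f') :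
    markovOp K f =ᵐ[μ'] markovOp K f' := by
  rw [← show K ∘ₘ μ' = μ' from hK] at h
  filter_upwards [Measure.ae_ae_of_ae_comp h] with x hx
  exact integral_congr_ae hx

theorem aestronglyMeasurable_markovOp (hK : K.Invariant μ') {f : E → ℝ}
    (hf : AEStronglyMeasurable f μ') : AEStronglyMeasurable (markovOp K f) μ' :=
  (measurable_markovOp K hf.stronglyMeasurable_mk.measurable).aestronglyMeasurable.congr
    (markovOp_congr hK hf.ae_eq_mk).symm

/-- Jensen's inequality: a Markov operator is a contraction of `L²` of an invariant measure. -/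
theorem eLpNorm_markovOp_le [IsMarkovKernel K] (hK : K.Invariant μ') {f : E → ℝ}
    (hf : AEStronglyMeasurable f μ') : eLpNorm (markovOp K f) 2 μ' ≤ eLpNorm f 2 μ' := by
  obtain ⟨f', hm, hff'⟩ := hf
  rw [eLpNorm_congr_ae (markovOp_congr hK hff'), eLpNorm_congr_ae hff']
  rw [← ENNReal.pow_le_pow_left_iff two_ne_zero, eLpNorm_two_sq, eLpNorm_two_sq]
  conv_rhs => rw [← show K ∘ₘ μ' = μ' from hK]
  rw [Measure.lintegral_bind (Kernel.aemeasurable _) (hm.enorm.pow_const 2).aemeasurable]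
  refine lintegral_mono fun x => ?_
  calc ‖markovOp K f' x‖ₑ ^ 2 ≤ eLpNorm f' 1 (K x) ^ 2 := by
        gcongr
        rw [eLpNorm_one_eq_lintegral_enorm]
        exact enorm_integral_le_lintegral_enorm _
    _ ≤ eLpNorm f' 2 (K x) ^ 2 := by
        gcongr
        exact eLpNorm_le_eLpNorm_of_exponent_le one_le_two hm.aestronglyMeasurable
    _ = _ := eLpNorm_two_sq _ _

/-- Finiteness is the point: `mixingGap` passes through `toReal`, which would send an infinite norm
to `0`. -/
theorem tripleNorm_markovOp_sub_meanOp_le_two [IsMarkovKernel K] [IsProbabilityMeasure μ']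
    (hK : K.Invariant μ') : tripleNorm μ' (fun f => markovOp K f - meanOp μ' f) ≤ 2 := by
  refine iSup_le fun f => iSup_le fun hf => iSup_le fun h1 => ?_
  refine (eLpNorm_sub_le (aestronglyMeasurable_markovOp hK hf.1) (by
    unfold meanOp; exact aestronglyMeasurable_const) one_le_two).trans ?_
  have h2 : eLpNorm (meanOp μ' f) 2 μ' ≤ 1 := by
    unfold meanOp
    rw [eLpNorm_const _ two_ne_zero (IsProbabilityMeasure.ne_zero μ')]
    simp only [measure_univ, ENNReal.one_rpow, mul_one]
    refine ((enorm_integral_le_lintegral_enorm f).trans ?_).trans h1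
    rw [← eLpNorm_one_eq_lintegral_enorm]
    exact eLpNorm_le_eLpNorm_of_exponent_le one_le_two hf.1
  refine (add_le_add ((eLpNorm_markovOp_le hK hf.1).trans h1) h2).trans (le_of_eq ?_)
  norm_num

/-- On centred functions the norm of `K` is bounded by that of `K - μ`. -/
theorem eLpNorm_markovOp_le_tripleNorm_mul [IsMarkovKernel K] (hK : K.Invariant μ')
    {f : E → ℝ} (hf : MemLp f 2 μ') (hf0 : ∫ x, f x ∂μ' = 0) :
    eLpNorm (markovOp K f) 2 μ' ≤
      tripleNorm μ' (fun f => markovOp K f - meanOp μ' f) * eLpNorm f 2 μ' := by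
  -- A function of norm zero cannot be normalised; contractivity settles that case.
  by_cases h0 : eLpNorm f 2 μ' = 0
  · have := eLpNorm_markovOp_le hK hf.1
    rw [h0] at this ⊢
    simpa using this
  set c := eLpNorm f 2 μ' with hc
  have hct : c ≠ ∞ := hf.2.ne
  have hcinv : ‖(c.toReal)⁻¹‖ₑ = c⁻¹ := by
    rw [enorm_inv (ENNReal.toReal_ne_zero.2 ⟨h0, hct⟩), Real.enorm_of_nonneg ENNReal.toReal_nonneg,
      ENNReal.ofReal_toReal hct]
  have h1 : eLpNorm (c.toReal⁻¹ • f) 2 μ' ≤ 1 := by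
    rw [eLpNorm_const_smul, hcinv, ← hc, ENNReal.inv_mul_cancel h0 hct]
  have h2 : markovOp K (c.toReal⁻¹ • f) - meanOp μ' (c.toReal⁻¹ • f) =
      c.toReal⁻¹ • markovOp K f := by
    ext x
    simp [markovOp, meanOp, integral_const_mul, hf0]
  have h3 : eLpNorm (c.toReal⁻¹ • markovOp K f) 2 μ' ≤
      tripleNorm μ' (fun f => markovOp K f - meanOp μ' f) := by
    rw [← h2]
    exact le_iSup_of_le (c.toReal⁻¹ • f) (le_iSup_of_le (hf.const_smul _) (le_iSup_of_le h1 le_rfl))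
  rw [eLpNorm_const_smul, hcinv] at h3
  calc eLpNorm (markovOp K f) 2 μ' = c⁻¹ * eLpNorm (markovOp K f) 2 μ' * c := by
        rw [mul_right_comm, ENNReal.inv_mul_cancel h0 hct, one_mul]
    _ ≤ _ := by gcongr

/-- In $\int g^2f^2\,d\mu$ one factor $g$ is bounded by $C$ and the other changes $\mu$ into $\mu'$.
Thus $\Gamma_g$ enters to the first power. -/
theorem eLpNorm_densityOp_sq_le (hg : Measurable g)
    (hμ' : μ' = μ.withDensity fun x => (g x : ℝ≥0∞)) {C : ℝ≥0∞} (hC : ∀ x, (g x : ℝ≥0∞) ≤ C)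
    {f : E → ℝ} (hf : Measurable f) :
    eLpNorm (densityOp g f) 2 μ ^ 2 ≤ C * eLpNorm f 2 μ' ^ 2 := by
  rw [eLpNorm_two_sq, eLpNorm_two_sq, hμ', lintegral_withDensity_eq_lintegral_mul _
    hg.coe_nnreal_ennreal (by fun_prop), ← lintegral_const_mul _ (by fun_prop)]
  refine lintegral_mono fun x => ?_
  have : ‖densityOp g f x‖ₑ = (g x : ℝ≥0∞) * ‖f x‖ₑ := by
    rw [densityOp, enorm_mul, Real.enorm_of_nonneg (g x).coe_nonneg, ENNReal.ofReal_coe_nnreal]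
  rw [this, Pi.mul_apply, mul_pow, sq, mul_assoc]
  gcongr
  exact hC x

end L2

/-! ### Iterating the operators and identifying the variance -/

section Propagation

variable {n : ℕ} {μ : ℕ → Measure E} {g : ℕ → E → ℝ≥0} {K : ℕ → Kernel E E}

theorem memLp_densityOp_markovOp {μ μ' : Measure E} {g : E → ℝ≥0} {K : Kernel E E}
    [IsMarkovKernel K] (hg : Measurable g) (hμ' : μ' = μ.withDensity fun x => (g x : ℝ≥0∞))
    {C : ℝ≥0∞} (hC : ∀ x, (g x : ℝ≥0∞) ≤ C) (hCt : C < ∞) (hK : K.Invariant μ') {f : E → ℝ}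
    (hfm : Measurable f) (hf : MemLp f 2 μ') : MemLp (densityOp g (markovOp K f)) 2 μ := by
  refine ⟨(measurable_densityOp hg (measurable_markovOp K hfm)).aestronglyMeasurable, ?_⟩
  have h1 := eLpNorm_densityOp_sq_le hg hμ' hC (measurable_markovOp K hfm)
  have h2 : eLpNorm (markovOp K f) 2 μ' < ∞ := (eLpNorm_markovOp_le hK hf.1).trans_lt hf.2
  have h3 := h1.trans_lt (ENNReal.mul_lt_top hCt (ENNReal.pow_lt_top h2))
  by_contra h
  rw [not_lt, top_le_iff] at h
  simp [h] at h3

/-- Induction backwards from stage $n$, one factor $\Gamma_g(1-\gamma_K)^2$ per step. The vanishing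
mean is carried along because the contraction is available only on centred functions. -/
theorem propagate_bound [∀ k, IsProbabilityMeasure (μ k)] (hg : ∀ k, Measurable (g k))
    (hμ : ∀ k < n, μ (k + 1) = (μ k).withDensity fun x => (g k x : ℝ≥0∞))
    (hΓ : maxDensity g n < ∞) [∀ k, IsMarkovKernel (K k)]
    (hK : ∀ k, 1 ≤ k → k ≤ n → (K k).Invariant (μ k)) {φ : E → ℝ} (hφm : Measurable φ)
    (hφ : MemLp φ 2 (μ n)) (hφ0 : ∫ x, φ x ∂(μ n) = 0) (j k : ℕ) (hjk : k + j = n) :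
    Measurable (propagate g K j k φ) ∧ MemLp (propagate g K j k φ) 2 (μ k) ∧
      ∫ x, propagate g K j k φ x ∂(μ k) = 0 ∧
      eLpNorm (propagate g K j k φ) 2 (μ k) ^ 2 ≤ (maxDensity g n * (⨆ k ∈ Finset.Icc 1 n,
        tripleNorm (μ k) (fun f => markovOp (K k) f - meanOp (μ k) f)) ^ 2) ^ j *
          eLpNorm φ 2 (μ n) ^ 2 := by
  induction j generalizing k with
  | zero =>
    rw [add_zero] at hjk
    subst hjk
    exact ⟨hφm, hφ, hφ0, by simp [propagate]⟩
  | succ j ih =>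
    have hk : k < n := by omega
    obtain ⟨h1, h2, h3, h4⟩ := ih (k + 1) (by omega)
    set ψ := propagate g K j (k + 1) φ with hψ
    have hKi := hK (k + 1) (by omega) (by omega)
    have hC := coe_le_maxDensity (g := g) hk
    have hp : propagate g K (j + 1) k φ = densityOp (g k) (markovOp (K (k + 1)) ψ) := rfl
    rw [hp]
    refine ⟨measurable_densityOp (hg k) (measurable_markovOp _ h1),
      memLp_densityOp_markovOp (hg k) (hμ k hk) hC hΓ hKi h1 h2, ?_, ?_⟩
    · rw [← integral_withDensity_coe (hg k) (hμ k hk),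
        (integrable_markovOp hKi h1 (h2.integrable one_le_two)).2.2, h3]
    · refine (eLpNorm_densityOp_sq_le (hg k) (hμ k hk) hC (measurable_markovOp _ h1)).trans ?_
      have h5 := (eLpNorm_markovOp_le_tripleNorm_mul hKi h2 h3).trans
        (mul_le_mul_left (le_iSup₂ (f := fun k (_ : k ∈ Finset.Icc 1 n) => tripleNorm (μ k)
          (fun f => markovOp (K k) f - meanOp (μ k) f)) (k + 1)
          (Finset.mem_Icc.2 ⟨by omega, by omega⟩)) _)
      refine (mul_le_mul_right (pow_le_pow_left₀ zero_le h5 2) _).trans ?_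
      generalize (⨆ i ∈ Finset.Icc 1 n, tripleNorm (μ i)
        (fun f => markovOp (K i) f - meanOp (μ i) f)) = T at h4 ⊢
      calc maxDensity g n * (T * eLpNorm ψ 2 (μ (k + 1))) ^ 2
          = maxDensity g n * T ^ 2 * eLpNorm ψ 2 (μ (k + 1)) ^ 2 := by ring
        _ ≤ maxDensity g n * T ^ 2 *
            ((maxDensity g n * T ^ 2) ^ j * eLpNorm φ 2 (μ n) ^ 2) := by gcongr
        _ = _ := by ring

/-- The definition peels off the outermost operator; the recursion in time adds a new stage
innermost. -/
theorem propagate_succ' (j k : ℕ) (f : E → ℝ) :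
    propagate g K (j + 1) k f =
      propagate g K j k (densityOp (g (k + j)) (markovOp (K (k + j + 1)) f)) := by
  induction j generalizing k with
  | zero => rfl
  | succ j ih =>
    rw [propagate, ih, show k + (j + 1) = k + 1 + j by omega]
    rfl

theorem asymptoticVar_succ (n : ℕ) (f : E → ℝ) :
    asymptoticVar μ g K (n + 1) f =
      asymptoticVar μ g K n (densityOp (g n) (markovOp (K (n + 1)) f)) +
        eLpNorm f 2 (μ (n + 1)) ^ 2 := by
  rw [asymptoticVar, Finset.sum_range_succ, asymptoticVar]
  congr 1
  · refine Finset.sum_congr rfl fun k hk => ?_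
    have hkn : k ≤ n := Nat.lt_succ_iff.1 (Finset.mem_range.1 hk)
    rw [stageVar, stageVar, Nat.succ_sub hkn, Nat.succ_eq_add_one, propagate_succ',
      Nat.add_sub_cancel' hkn]
  · simp [stageVar, propagate]

/-- The statements are proved together because their induction steps feed one another. The real
functional `V` is matched with `asymptoticVar` only on $L^2$, where the latter is finite. -/
theorem empiricalCLT_particleLaw [∀ k, IsProbabilityMeasure (μ k)] (hg : ∀ k, Measurable (g k))
    (hμ : ∀ k < n, μ (k + 1) = (μ k).withDensity fun x => (g k x : ℝ≥0∞))
    (hΓ : maxDensity g n < ∞) [∀ k, IsMarkovKernel (K k)]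
    (hK : ∀ k, 1 ≤ k → k ≤ n → (K k).Invariant (μ k)) (k : ℕ) (hk : k ≤ n) :
    EmpiricalLLN (fun N => particleLaw (μ 0) g hg K N k) (μ k) ∧
      AvoidsNull (fun N => particleLaw (μ 0) g hg K N k) (μ k) ∧
      ∃ V : (E → ℝ) → ℝ, (∀ f, 0 ≤ V f) ∧
        EmpiricalCLT (fun N => particleLaw (μ 0) g hg K N k) (μ k) V ∧
        ∀ f, Measurable f → MemLp f 2 (μ k) →
          asymptoticVar μ g K k f = ENNReal.ofReal (V f) := by
  induction k with
  | zero =>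
    refine ⟨empiricalLLN_pi _, avoidsNull_pi _, _, fun f => integral_nonneg fun x => sq_nonneg _,
      empiricalCLT_pi _, fun f _ hf => ?_⟩
    simp [asymptoticVar, stageVar, propagate, eLpNorm_two_sq_eq_ofReal hf]
  | succ k ih =>
    obtain ⟨h1, h2, V, hV0, hV, hVe⟩ := ih (by omega)
    have hKi := hK (k + 1) (by omega) hk
    have hstep : ∀ (N : ℕ) [NeZero N], particleLaw (μ 0) g hg K N (k + 1) =
        particleStep N (hg k) (K (k + 1)) ∘ₘ particleLaw (μ 0) g hg K N k := fun N _ =>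
      particleLaw_succ hg K k
    have hQ : ∀ f, Measurable f → MemLp f 2 (μ (k + 1)) →
        MemLp (densityOp (g k) (markovOp (K (k + 1)) f)) 2 (μ k) := fun f hfm hf =>
      memLp_densityOp_markovOp (hg k) (hμ k hk) (coe_le_maxDensity hk) hΓ hKi hfm hf
    refine ⟨h1.step h2 (hg k) (hμ k hk) hKi hstep, h2.step h1 (hg k) (hμ k hk) hKi hstep, _,
      fun f => add_nonneg (hV0 _) (integral_nonneg fun x => sq_nonneg _),
      hV.step h1 h2 (hg k) (hμ k hk) hKi hQ hstep, fun f hfm hf => ?_⟩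
    rw [asymptoticVar_succ, hVe _ (measurable_densityOp (hg k) (measurable_markovOp _ hfm))
      (hQ f hfm hf), eLpNorm_two_sq_eq_ofReal hf,
      ENNReal.ofReal_add (hV0 _) (integral_nonneg fun x => sq_nonneg _)]

end Propagation

end SMC

/-! ### The main theorem -/

theorem mainTheorem4 {E : Type*} [MeasurableSpace E] [StandardBorelSpace E] (n : ℕ)
    (μ : ℕ → Measure E) [∀ k, IsProbabilityMeasure (μ k)]
    (hμ : ∀ k < n, μ (k + 1) ≪ μ k)
    (g : ℕ → E → ℝ≥0) (hg : ∀ k, Measurable (g k))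
    (hgμ : ∀ k < n, (fun x => (g k x : ℝ≥0∞)) =ᵐ[μ k] (μ (k + 1)).rnDeriv (μ k))
    (hΓ : SMC.maxDensity g n < ∞)
    (K : ℕ → Kernel E E) [∀ k, IsMarkovKernel (K k)]
    (hK : ∀ k, 1 ≤ k → k ≤ n → (K k).Invariant (μ k))
    (φ : E → ℝ) (hφ : SMC.MemL2PlusZero (μ n) φ)
    (hmix : (SMC.maxDensity g n).toReal * (1 - SMC.mixingGap μ K n) ^ 2 < 1) :
    SMC.asymptoticVar μ g K n φ < ∞ ∧
    TendstoInDistribution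
      (fun (N : ℕ) (x : Fin N → E) => √(N : ℝ) * (SMC.empiricalMean φ x - ∫ y, φ y ∂(μ n)))
      atTop id (fun N => SMC.particleLaw (μ 0) g hg K N n)
      (gaussianReal 0 (SMC.asymptoticVar μ g K n φ).toNNReal) ∧
    (SMC.asymptoticVar μ g K n φ).toReal ≤
      1 / (1 - (1 - SMC.mixingGap μ K n) ^ 2 * (SMC.maxDensity g n).toReal) *
        Var[φ; μ n] := by
  obtain ⟨hφm, ⟨ε, hε, hφε⟩, hφ0⟩ := hφ
  have hφ2 : MemLp φ 2 (μ n) := hφε.mono_exponent (by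
    rw [← ENNReal.ofReal_ofNat 2]
    exact ENNReal.ofReal_le_ofReal (by linarith))
  have hμg : ∀ k < n, μ (k + 1) = (μ k).withDensity fun x => (g k x : ℝ≥0∞) := fun k hk => by
    rw [withDensity_congr_ae (hgμ k hk), Measure.withDensity_rnDeriv_eq _ _ (hμ k hk)]
  obtain ⟨-, -, V, hV0, hclt, hVe⟩ := SMC.empiricalCLT_particleLaw hg hμg hΓ hK n le_rfl
  have hVφ := hVe φ hφm hφ2
  refine ⟨hVφ ▸ ENNReal.ofReal_lt_top, ?_, ?_⟩
  · have hXm : ∀ N, Measurable fun x : Fin N → E =>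
        √(N : ℝ) * (SMC.empiricalMean φ x - ∫ y, φ y ∂(μ n)) := fun N =>
      ((SMC.measurable_empiricalMean hφm).sub_const _).const_mul _
    refine ⟨fun N => (hXm N).aemeasurable, aemeasurable_id, ?_⟩
    refine ProbabilityMeasure.tendsto_iff_tendsto_charFun.2 fun t => ?_
    simp only [ProbabilityMeasure.coe_mk, charFun_map_real (hXm _), Measure.map_id,
      charFun_gaussianReal]
    simp only [hφ0, sub_zero]
    have hv : ((SMC.asymptoticVar μ g K n φ).toNNReal : ℝ) = V φ := by
      rw [hVφ]
      exact ENNReal.toReal_ofReal (hV0 φ)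
    refine (hclt φ hφm hφ2 hφ0 t).trans (le_of_eq ?_)
    rw [hv]
    congr 2
    push_cast
    ring
  · set T := ⨆ k ∈ Finset.Icc 1 n,
      SMC.tripleNorm (μ k) (fun f => SMC.markovOp (K k) f - SMC.meanOp (μ k) f) with hT
    -- Needed to recover `T` from `T.toReal`, which is what `mixingGap` records.
    have hTt : T < ∞ := lt_of_le_of_lt (iSup₂_le fun k hk =>
      SMC.tripleNorm_markovOp_sub_meanOp_le_two
        (hK k (Finset.mem_Icc.1 hk).1 (Finset.mem_Icc.1 hk).2)) ENNReal.ofNat_lt_top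
    have hgap : 1 - SMC.mixingGap μ K n = T.toReal := by
      rw [SMC.mixingGap, sub_sub_cancel]
    rw [hgap] at hmix ⊢
    set r : ℝ := T.toReal ^ 2 * (SMC.maxDensity g n).toReal with hr
    have hr0 : 0 ≤ r := by positivity
    have hr1 : r < 1 := by rwa [mul_comm] at hmix
    have hvar : Var[φ; μ n] = ∫ x, φ x ^ 2 ∂(μ n) :=
      variance_of_integral_eq_zero hφm.aemeasurable hφ0
    have hv0 : 0 ≤ ∫ x, φ x ^ 2 ∂(μ n) := integral_nonneg fun x => sq_nonneg _
    rw [hvar]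
    have hrE : SMC.maxDensity g n * T ^ 2 = ENNReal.ofReal r := by
      rw [hr, ENNReal.ofReal_mul (by positivity), ENNReal.ofReal_pow ENNReal.toReal_nonneg,
        ENNReal.ofReal_toReal hTt.ne, ENNReal.ofReal_toReal hΓ.ne, mul_comm]
    have hb : SMC.asymptoticVar μ g K n φ ≤
        ENNReal.ofReal (∑ j ∈ Finset.range (n + 1), r ^ j * ∫ x, φ x ^ 2 ∂(μ n)) := by
      -- Reindexing by the distance `j = n - k` to the final stage makes the summands comparable
      -- with `r ^ j`.
      rw [SMC.asymptoticVar, ← Finset.sum_range_reflect,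
        ENNReal.ofReal_sum_of_nonneg fun j _ => by positivity]
      refine Finset.sum_le_sum fun j hj => ?_
      have hj : j ≤ n := Nat.lt_succ_iff.1 (Finset.mem_range.1 hj)
      have := (SMC.propagate_bound hg hμg hΓ hK hφm hφ2 hφ0 j (n - j) (by omega)).2.2.2
      rw [← hT, hrE, eLpNorm_two_sq_eq_ofReal hφ2, ← ENNReal.ofReal_pow hr0,
        ← ENNReal.ofReal_mul (by positivity)] at this
      rwa [SMC.stageVar, show n + 1 - 1 - j = n - j by omega, show n - (n - j) = j by omega]
    refine (ENNReal.toReal_mono ENNReal.ofReal_ne_top hb).trans ?_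
    rw [ENNReal.toReal_ofReal (Finset.sum_nonneg fun j _ => by positivity), ← Finset.sum_mul]
    gcongr
    rw [one_div, ← tsum_geometric_of_lt_one hr0 hr1]
    exact (summable_geometric_of_lt_one hr0 hr1).sum_le_tsum _ fun j _ => by positivity
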